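/- **Setting.** An instance $\mathcal I$ of a stochastic probing problem consists of $n$ items, where item $i$ carries an independent random variable $X_i$ with a known finite set of $k_i\ge 1$ possible real values $a_{i,1}<\dots<a_{i,k_i}$; put $k=\max_i k_i$. A policy $\sigma$ is a decision tree: each internal node probes an item and branches on its outcome, no item is probed twice in an execution, and the policy may stop at any state. On a realization $\mathbf x=(x_1,\dots,x_n)$ the policy probes a sequence $S(\sigma,\mathbf x)$ of items; the objective $f(\sigma,\mathbf x)\ge 0$ depends only on the sequence of probed items and their outcomes. A non-empty set $\mathcal C$ of feasible policies is given, and $f(\sigma,\mathbf x)\le f_{\max}$ for all $\sigma\in\mathcal C$ and all $\mathbf x$. For product distributions $\mathbf D=(\mathcal D_i)$ with $\mathcal D_i$ supported on $\{a_{i,j}\}_j$, let $f(\sigma\mid\mathbf D)=\mathbb E_{\mathbf x\sim\mathbf D}f(\sigma,\mathbf x)$, and let $\mathrm{OPT}_{\mathcal I}(\mathbf D)$ be the minimum (for minimization problems) or the maximum (for maximization problems) of $f(\sigma\mid\mathbf D)$ over $\sigma\in\mathcal C$. A problem $\mathcal P$ is a class of instances with one optimization sense. $\mathbf E$ stochastically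 dominates $\mathbf D$ if $\Pr_{\mathcal E_i}(X_i\ge a)\ge\Pr_{\mathcal D_i}(X_i\ge a)$ for all $i$ and all $a\in\mathbb R$. $\mathcal P$ is *up-monotone* (resp. *down-monotone*) if for every instance, $\mathrm{OPT}_{\mathcal I}(\mathbf E)\le\mathrm{OPT}_{\mathcal I}(\mathbf D)$ (resp. $\ge$) whenever $\mathbf E$ stochastically dominates $\mathbf D$. An *$\alpha$-approximation algorithm* $\mathtt{ALG}$ for $\mathcal P$ returns, for every instance and every $\mathbf D$, a feasible policy $\sigma$ with $f(\sigma\mid\mathbf D)\le\alpha\,\mathrm{OPT}_{\mathcal I}(\mathbf D)$, $\alpha\ge1$ (minimization), or $f(\sigma\mid\mathbf D)\ge\alpha\,\mathrm{OPT}_{\mathcal I}(\mathbf D)$, $0<\alpha\le1$ (maximization). **Online problem.** The distribution $\mathbf D$ is unknown. In each period $t=1,\dots,T$ the learner chooses a feasible policy $\sigma^t$ from its past observations, an independent realization $\mathbf x^t\sim\mathbf D$ occurs, and the learner observes only the outcomes of the items that $\sigma^t$ probed (semi-bandit feedback). The expected $\alpha$-regret is $\mathbb E\big[\sum_{t=1}^Tf(\sigma^t,\mathbf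 x^t)\big]-\alpha\,T\,\mathrm{OPT}_{\mathcal I}(\mathbf D)$ for minimization, and $\alpha\,T\,\mathrm{OPT}_{\mathcal I}(\mathbf D)-\mathbb E\big[\sum_{t=1}^Tf(\sigma^t,\mathbf x^t)\big]$ for maximization. **Optimistic algorithm.** Let $\delta=2/(nT)^3$. In each period, for each item $i$ with $m$ samples observed so far, let $\varepsilon=\sqrt{\log(2/\delta)/(2m)}$ ($\varepsilon=\infty$ if $m=0$) and let $\mathcal E_i$ be the empirical distribution with mass $\varepsilon$ removed from its lowest values and added to the highest possible value $a_{i,k_i}$ (a point mass at $a_{i,k_i}$ if the latter would receive probability at least $1$). This is used for up-monotone minimization and down-monotone maximization problems; in the other two cases, the order of the values is reversed. Then $\sigma^t=\mathtt{ALG}(\mathcal E_1,\dots,\mathcal E_n)$ is used. **Theorem 1.** There is an absolute constant $C$ such that the following holds. Let $\mathcal P$ be a stochastic probing problem that is up-monotone or down-monotone and has an $\alpha$-approximation algorithm $\mathtt{ALG}$. Then for every instance of $\mathcal P$ with $n$ items and every $T$ with $nT\ge2$: 1. for every $\mathbf D$, the optimistic algorithm has expected $\alpha$-regret at most $$C\,n\,k\,f_{\max}\sqrt{T\log(nT)};$$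 2. if $\mathtt{ALG}$ needs at most $B$ steps on this instance to compute a policy, and at most $B$ steps to determine the action (next item, or stop) at any state reached in its execution, then on all realizations the optimistic algorithm runs in at most $C\,n\,T\,(k+B)$ steps over the $T$ periods, a step being one arithmetic operation on real numbers (including square root and logarithm), comparison, memory access or loop iteration. In particular it is a polynomial-time algorithm if $\mathtt{ALG}$ is. -/

import Mathlib

open scoped BigOperators

noncomputable section

namespace Probing

/-! ### Step counting

Unit-cost computations: a computation is a result together with the number of elementary steps used.
One elementary step is one arithmetic operation on numbers (`+ - * /`, square root, logarithm), one
comparison, one read or write of a memory cell, or the bookkeeping of one loop iteration. -/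

/-- The result of a computation and the number of elementary steps it used. -/
structure Timed (β : Type) where
  val : β
  steps : ℕ

namespace Timed

instance : Monad Timed where
  pure b := ⟨b, 0⟩
  bind x g := ⟨(g x.val).val, x.steps + (g x.val).steps⟩

/-- One elementary operation with result `b`. -/
def op {β : Type} (b : β) : Timed β := ⟨b, 1⟩

/-- One elementary operation without a result (a comparison or a memory access). -/
def tick : Timed Unit := ⟨(), 1⟩

/-- `for a in l do body`, with a state `b`; each iteration costs one extra step. -/
def forEach {ι β : Type} : List ι → (ι → β → Timed β) → β → Timed β
  | [], _, b => pure b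
  | a :: l, body, b => do
      tick
      let b' ← body a b
      forEach l body b'

/-- Fill an array with `N` entries, entry `i` being computed by `g i` and then written. -/
def fill {N : ℕ} {β : Fin N → Type} (blank : ∀ i, β i) (g : ∀ i, Timed (β i)) :
    Timed (∀ i, β i) :=
  forEach (List.finRange N)
    (fun i A => do
      let v ← g i
      tick
      pure (Function.update A i v)) blank

end Timed

/-! ### Policies -/

/-- Decision trees over `n` items, item `i` having `k i` outcomes: a node either stops, or probes an
item and branches on its outcome. -/
inductive DTree {n : ℕ} (k : Fin n → ℕ) : Type
  | leaf : DTree k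
  | probe (i : Fin n) (next : Fin (k i) → DTree k) : DTree k

/-- A state of a policy: the sequence of probed items with their outcomes. -/
abbrev State {n : ℕ} (k : Fin n → ℕ) : Type := List (Σ i : Fin n, Fin (k i))

namespace DTree

variable {n : ℕ} {k : Fin n → ℕ}

/-- The terminal state reached under the realization `x`: the sequence of all items probed by the
policy, with their outcomes. -/
def run : DTree k → (∀ i, Fin (k i)) → State k
  | leaf, _ => []
  | probe i next, x => ⟨i, x i⟩ :: run (next (x i)) x

/-- No item is probed twice in an execution. -/
def ProbesOnce (σ : DTree k) : Prop :=
  ∀ x, ((σ.run x).map Sigma.fst).Nodup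

end DTree

/-! ### Stochastic probing problems -/

/-- An instance of a stochastic probing problem, without the probability distributions. Outcomes of
item `i` are indexed by `Fin (k i)`, in increasing order of their values. -/
structure ProbingInstance where
  /-- number of items -/
  n : ℕ
  /-- number of possible outcomes of each item -/
  k : Fin n → ℕ
  k_pos : ∀ i, 0 < k i
  /-- the values of the outcomes -/
  value : ∀ i, Fin (k i) → ℝ
  value_strictMono : ∀ i, StrictMono (value i)
  /-- the feasible policies -/
  feasible : Set (DTree k)
  feasible_nonempty : feasible.Nonempty
  feasible_probesOnce : ∀ σ ∈ feasible, σ.ProbesOnce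
  /-- the objective, a function of the terminal state -/
  f : State k → ℝ
  f_nonneg : ∀ σ ∈ feasible, ∀ x, 0 ≤ f (σ.run x)

namespace ProbingInstance

variable (I : ProbingInstance)

/-- A joint realization: an outcome for every item. -/
abbrev Realization : Type := ∀ i, Fin (I.k i)

/-- Tables of real numbers indexed by items and outcomes. -/
abbrev Weights : Type := ∀ i, Fin (I.k i) → ℝ

/-- `D` gives a probability distribution on the outcomes of every item. -/
def IsDist (D : I.Weights) : Prop := ∀ i, D i ∈ stdSimplex ℝ (Fin (I.k i))

/-- Probability of a joint realization when the items are independent. -/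
def prob (D : I.Weights) (x : I.Realization) : ℝ := ∏ i, D i (x i)

/-- Expected objective `f(σ | D)` of a policy. -/
def expValue (D : I.Weights) (σ : DTree I.k) : ℝ := ∑ x, I.prob D x * I.f (σ.run x)

/-- The maximum support size. -/
def maxSupport : ℕ := Finset.univ.sup I.k

/-- `E` stochastically dominates `D`: `Pr_E (X_i ≥ a) ≥ Pr_D (X_i ≥ a)` for all items `i` and all
real `a`. -/
def Dominates (E D : I.Weights) : Prop :=
  ∀ (i : Fin I.n) (a : ℝ),
    ∑ j with a ≤ I.value i j, D i j ≤ ∑ j with a ≤ I.value i j, E i j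

end ProbingInstance

/-- Minimization or maximization. -/
inductive Sense
  | min
  | max

/-- The two kinds of monotonicity. -/
inductive Monotonicity
  | up
  | down

/-- The optimal value under the distributions `D`. -/
def ProbingInstance.opt (I : ProbingInstance) (s : Sense) (D : I.Weights) : ℝ :=
  match s with
  | .min => ⨅ σ : I.feasible, I.expValue D σ.1
  | .max => ⨆ σ : I.feasible, I.expValue D σ.1

/-- A stochastic problem: an optimization sense and a class of instances. -/
structure Problem where
  sense : Sense
  instances : Set ProbingInstance

/-- Up-monotone: a stochastically larger distribution has an optimal value that is no larger;
down-monotone: a stochastically larger distribution has an optimal value that is no smaller. -/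
def Problem.IsMonotone (P : Problem) : Monotonicity → Prop
  | .up => ∀ I ∈ P.instances, ∀ D E : I.Weights, I.IsDist D → I.IsDist E → I.Dominates E D →
      I.opt P.sense E ≤ I.opt P.sense D
  | .down => ∀ I ∈ P.instances, ∀ D E : I.Weights, I.IsDist D → I.IsDist E → I.Dominates E D →
      I.opt P.sense D ≤ I.opt P.sense E

/-! ### Offline algorithms -/

/-- A policy that can be executed: a decision tree (not written out) together with the number of
steps needed, at each state, to determine the action (which item to probe next, or to stop). -/
structure ExecutablePolicy (I : ProbingInstance) where
  tree : DTree I.k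
  nodeSteps : State I.k → ℕ

/-- Steps used for executing a policy on the realization `x`: the states visited are the prefixes of
the terminal state, and at each of them the action is determined and performed. -/
def ExecutablePolicy.execSteps {I : ProbingInstance} (π : ExecutablePolicy I)
    (x : I.Realization) : ℕ :=
  ((π.tree.run x).inits.map (fun s => π.nodeSteps s + 1)).sum

/-- An offline algorithm maps an instance and probability distributions to a policy. -/
abbrev OfflineAlgorithm : Type :=
  (I : ProbingInstance) → I.Weights → Timed (ExecutablePolicy I)

/-- `ALG` is an `α`-approximation algorithm for `P`. -/
def Problem.IsApproximation (P : Problem) (α : ℝ) (ALG : OfflineAlgorithm) : Prop :=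
  (match P.sense with
    | .min => 1 ≤ α
    | .max => 0 < α ∧ α ≤ 1) ∧
  ∀ I ∈ P.instances, ∀ D : I.Weights, I.IsDist D →
    (ALG I D).val.tree ∈ I.feasible ∧
    (match P.sense with
      | .min => I.expValue D (ALG I D).val.tree ≤ α * I.opt .min D
      | .max => α * I.opt .max D ≤ I.expValue D (ALG I D).val.tree)

/-- `B` bounds the number of steps that `ALG` needs, on the instance `I`, for computing a policy and
for determining the action at any state reached in an execution of that policy. -/
def OfflineAlgorithm.StepsLE (ALG : OfflineAlgorithm) (I : ProbingInstance) (B : ℕ) : Prop :=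
  ∀ D : I.Weights, I.IsDist D →
    (ALG I D).steps ≤ B ∧
    ∀ x : I.Realization, ∀ s ∈ ((ALG I D).val.tree.run x).inits, (ALG I D).val.nodeSteps s ≤ B

/-! ### Online learning with semi-bandit feedback -/

/-- A learning algorithm with semi-bandit feedback: in every period it selects a policy from its
memory, and then updates its memory with the items probed in this period and their outcomes. -/
structure Learner (I : ProbingInstance) where
  Mem : Type
  start : Timed Mem
  select : Mem → Timed (ExecutablePolicy I)
  observe : Mem → State I.k → Timed Mem

namespace Learner

variable {I : ProbingInstance} (L : Learner I)

/-- Total objective over the periods with realizations `xs`, starting from memory `μ`. -/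
def totalFrom : L.Mem → List I.Realization → ℝ
  | _, [] => 0
  | μ, x :: xs =>
      let s := (L.select μ).val.tree.run x
      I.f s + totalFrom (L.observe μ s).val xs

/-- Number of steps over the periods with realizations `xs`, starting from memory `μ`. -/
def stepsFrom : L.Mem → List I.Realization → ℕ
  | _, [] => 0
  | μ, x :: xs =>
      let σ := L.select μ
      let s := σ.val.tree.run x
      σ.steps + σ.val.execSteps x + (L.observe μ s).steps + stepsFrom (L.observe μ s).val xs

/-- Total number of steps over `T` periods. -/
def totalSteps {T : ℕ} (h : Fin T → I.Realization) : ℕ :=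
  L.start.steps + L.stepsFrom L.start.val (List.ofFn h)

/-- Expected total objective over `T` periods, whose realizations are independent with distribution
`D`. -/
def expTotal (D : I.Weights) (T : ℕ) : ℝ :=
  ∑ h : Fin T → I.Realization,
    (∏ t, I.prob D (h t)) * L.totalFrom L.start.val (List.ofFn h)

/-- Expected `α`-regret over `T` periods. -/
def regret (s : Sense) (α : ℝ) (D : I.Weights) (T : ℕ) : ℝ :=
  match s with
  | .min => L.expTotal D T - α * T * I.opt .min D
  | .max => α * T * I.opt .max D - L.expTotal D T

end Learner

/-! ### The optimistic algorithm -/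

/-- Optimistic distribution for one item with `K` outcomes from the numbers `c j` of samples of each
outcome: the empirical distribution, with mass `ε = √(log (2/δ) / (2m))` moved from the lowest
outcomes to the highest one, `m` being the number of samples. If `m = 0` then `ε = ∞`: all the
mass is on the highest outcome. -/
def empStocDom {K : ℕ} (hK : 0 < K) (δ : ℝ) (c : Fin K → ℕ) : Timed (Fin K → ℝ) := do
  let top : Fin K := ⟨K - 1, Nat.sub_lt hK Nat.one_pos⟩
  let pointMass : Timed (Fin K → ℝ) :=
    Timed.fill (fun _ => 0) (fun j => do Timed.tick; pure (if j = top then 1 else 0))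
  let m ← Timed.forEach (List.finRange K) (fun j (s : ℕ) => Timed.op (s + c j)) 0
  Timed.tick
  if m = 0 then
    pointMass
  else do
    let r ← Timed.op (2 / δ)
    let l ← Timed.op (Real.log r)
    let d ← Timed.op (2 * (m : ℝ))
    let q ← Timed.op (l / d)
    let ε ← Timed.op (Real.sqrt q)
    let p ← Timed.fill (fun _ => (0 : ℝ)) (fun j => Timed.op ((c j : ℝ) / (m : ℝ)))
    let pTop ← Timed.op (p top + ε)
    Timed.tick
    if 1 ≤ pTop then
      pointMass
    else do
      -- the least index `y` with `∑ j ≤ y, p j ≥ ε`, together with this sum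
      let found ← Timed.forEach (List.finRange K)
        (fun j (st : ℝ × Option (Fin K × ℝ)) => do
          let s ← Timed.op (st.1 + p j)
          Timed.tick
          Timed.tick
          pure (s, if st.2.isNone ∧ ε ≤ s then some (j, s) else st.2))
        (0, none)
      match found.2 with
      | none => pointMass
      | some (y, s) =>
        let rest ← Timed.op (s - ε)
        Timed.fill (fun _ => (0 : ℝ)) (fun j => do
          Timed.tick
          Timed.tick
          Timed.tick
          pure (if j = top then pTop else if y < j then p j else if j = y then rest else 0))

/-- The mirror image of `empStocDom`: the outcomes are taken in decreasing order. -/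
def empStocDomDown {K : ℕ} (hK : 0 < K) (δ : ℝ) (c : Fin K → ℕ) : Timed (Fin K → ℝ) := do
  let c' ← Timed.fill (fun _ => (0 : ℕ)) (fun j => Timed.op (c (Fin.rev j)))
  let p ← empStocDom hK δ c'
  Timed.fill (fun _ => (0 : ℝ)) (fun j => Timed.op (p (Fin.rev j)))

/-- Whether the optimistic distribution is to dominate the true one, or to be dominated by it. -/
def optimisticUp : Sense → Monotonicity → Bool
  | .min, .up => true
  | .min, .down => false
  | .max, .up => false
  | .max, .down => true

/-- The online algorithm for the horizon `T`. The memory holds, for each item, the number of times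
that each outcome has been observed. In every period, `ALG` is run on the optimistic distributions
with `δ = 2 / (n T) ^ 3`, and the policy that it returns is used. -/
def onlineToOffline (P : Problem) (M : Monotonicity) (ALG : OfflineAlgorithm)
    (I : ProbingInstance) (T : ℕ) : Learner I where
  Mem := ∀ i, Fin (I.k i) → ℕ
  start := Timed.fill (fun _ _ => 0) (fun _ => Timed.fill (fun _ => 0) (fun _ => Timed.op 0))
  select c := do
    let a ← Timed.op ((I.n : ℝ) * (T : ℝ))
    let b ← Timed.op (a * a)
    let d ← Timed.op (b * a)
    let δ ← Timed.op (2 / d)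
    let E ← Timed.fill (fun _ _ => (0 : ℝ)) (fun i =>
      if optimisticUp P.sense M then empStocDom (I.k_pos i) δ (c i)
      else empStocDomDown (I.k_pos i) δ (c i))
    ALG I E
  observe c s :=
    Timed.forEach s
      (fun o (c : ∀ i, Fin (I.k i) → ℕ) => do
        let v ← Timed.op (c o.1 o.2 + 1)
        Timed.tick
        pure (Function.update c o.1 (Function.update (c o.1) o.2 v))) c

end Probing

end

/-! Regret. As long as every empirical distribution is within its confidence radius of the true one
on all initial and final segments, the optimistic distributions E dominate D, or are dominated by
it, in the direction that makes OPT(E) no worse than OPT(D) (`sign_mul_opt_optimisticWeights_le`).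
The policy σ returned for E is therefore good enough when evaluated under E. Passing from E to D
costs at most F times the D-expected sum of the ℓ¹-errors of the items that σ probes
(`DTree.abs_treeExp_sub_le`). An error is thus paid for only when the item is probed, which also
yields a new sample of it. So the errors of one item are charged to distinct sample numbers m, and
the sum of 1/√m gives √T (`remainingWeight_record`, `sum_distBound_le`).

Inaccurate estimates are controlled by a potential instead of a union bound over events. For every
item, segment, sign and sample number there is an exponential supermartingale from Hoeffding's
lemma. Their sum `deviationPotential` starts at 4nKT, does not grow in expectation, and is at least
(nT)³ at every state with an inaccurate estimate (`two_div_le_deviationPotential`). Divided by (nT)³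
it bounds the indicator of failure, and a failing period costs at most F.

Both charges form one function of the counts and of the number of periods left, and induction on
that number (`Learner.mul_expTotalFrom_le`, `sign_mul_expTotalFrom_le`) takes the place of
filtrations and stopping times. Expectations over joint realizations become recursions along the
tree (`DTree.sum_prod_mul_run`) because no item is probed twice.

Running time. The costs of the loops add up; a run visits at most n + 1 states. -/

namespace Probing

/-! ### Values and costs of timed loops -/

namespace Timed

variable {β γ : Type}

@[simp] theorem val_pure (b : β) : (pure b : Timed β).val = b := rfl
@[simp] theorem steps_pure (b : β) : (pure b : Timed β).steps = 0 := rfl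
@[simp] theorem val_bind (x : Timed β) (g : β → Timed γ) : (x >>= g).val = (g x.val).val := rfl
@[simp] theorem steps_bind (x : Timed β) (g : β → Timed γ) :
    (x >>= g).steps = x.steps + (g x.val).steps := rfl
@[simp] theorem val_op (b : β) : (op b).val = b := rfl
@[simp] theorem steps_op (b : β) : (op b).steps = 1 := rfl
@[simp] theorem steps_tick : tick.steps = 1 := rfl

theorem val_forEach {ι : Type} (l : List ι) (body : ι → β → Timed β) (b : β) :
    (forEach l body b).val = l.foldl (fun b a => (body a b).val) b := by
  induction l generalizing b with
  | nil => rfl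
  | cons a l ih => simp [forEach, ih]

theorem steps_forEach_le {ι : Type} (l : List ι) (body : ι → β → Timed β) (b : β) (N : ℕ)
    (h : ∀ a b, (body a b).steps ≤ N) : (forEach l body b).steps ≤ l.length * (N + 1) := by
  induction l generalizing b with
  | nil => simp [forEach]
  | cons a l ih =>
    have h1 := ih (body a b).val
    have h2 := h a b
    simp only [forEach, steps_bind, steps_tick, List.length_cons]
    rw [Nat.add_mul]
    omega

theorem foldl_update {N : ℕ} {β : Fin N → Type} (g : ∀ i, β i) (l : List (Fin N)) (A : ∀ i, β i) :
    l.foldl (fun A i => Function.update A i (g i)) A = fun i => if i ∈ l then g i else A i := by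
  induction l generalizing A with
  | nil => simp
  | cons a l ih =>
    rw [List.foldl_cons, ih]
    funext i
    by_cases hl : i ∈ l
    · simp [hl]
    · by_cases ha : i = a
      · subst ha; simp
      · simp [hl, ha]

@[simp] theorem val_fill {N : ℕ} {β : Fin N → Type} (blank : ∀ i, β i) (g : ∀ i, Timed (β i)) :
    (fill blank g).val = fun i => (g i).val := by
  simp [fill, val_forEach, foldl_update]

theorem steps_fill_le {N : ℕ} {β : Fin N → Type} (blank : ∀ i, β i) (g : ∀ i, Timed (β i)) (M : ℕ)
    (h : ∀ i, (g i).steps ≤ M) : (fill blank g).steps ≤ N * (M + 2) := by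
  have := steps_forEach_le (List.finRange N) (fun i (A : ∀ i, β i) => do
      let v ← g i
      tick
      pure (Function.update A i v)) blank (M + 1) (by
        intro a b
        simpa using h a)
  simpa [fill] using this

end Timed

/-! ### The optimistic distribution as a truncated shift of the distribution function -/

/-- The radius of the confidence intervals after `m` samples. -/
noncomputable def confRadius (δ : ℝ) (m : ℕ) : ℝ := Real.sqrt (Real.log (2 / δ) / (2 * (m : ℝ)))

theorem confRadius_nonneg (δ : ℝ) (m : ℕ) : 0 ≤ confRadius δ m := Real.sqrt_nonneg _

/-- Scanning a list for the first partial sum that reaches `ε`. -/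
theorem foldl_firstReach {ι : Type} (p : ι → ℝ) (ε : ℝ) (l : List ι) (s₀ : ℝ) (h₀ : s₀ ≤ ε) :
    match (l.foldl (fun (st : ℝ × Option (ι × ℝ)) j =>
        (st.1 + p j, if st.2.isNone ∧ ε ≤ st.1 + p j then some (j, st.1 + p j) else st.2))
        (s₀, none)).2 with
    | none => s₀ + (l.map p).sum ≤ ε
    | some (y, s) => ∃ l₁ l₂, l = l₁ ++ y :: l₂ ∧ s = s₀ + (l₁.map p).sum + p y ∧ ε ≤ s ∧
        s₀ + (l₁.map p).sum ≤ ε := by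
  -- Once an index has been found, the rest of the scan leaves it alone.
  have stay : ∀ (l : List ι) (s : ℝ) (z : ι × ℝ),
      (l.foldl (fun (st : ℝ × Option (ι × ℝ)) j =>
        (st.1 + p j, if st.2.isNone ∧ ε ≤ st.1 + p j then some (j, st.1 + p j) else st.2))
        (s, some z)).2 = some z := by
    intro l
    induction l with
    | nil => intro s z; rfl
    | cons a l ih => intro s z; simpa using ih _ z
  induction l generalizing s₀ with
  | nil => simpa using h₀
  | cons a l ih =>
    by_cases h : ε ≤ s₀ + p a
    · simp only [List.foldl_cons, Option.isNone_none, h, and_self, if_true, stay]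
      exact ⟨[], l, rfl, by simp, trivial, by simpa using h₀⟩
    · simp only [List.foldl_cons, Option.isNone_none, h, and_false, if_false]
      have := ih (s₀ + p a) (le_of_not_ge h)
      revert this
      split
      · intro this; simpa [add_assoc] using this
      · rintro ⟨l₁, l₂, h1, h2, h3, h4⟩
        exact ⟨a :: l₁, l₂, by simp [h1], by simp [h2, add_assoc], h3, by simpa [add_assoc] using h4⟩

/-- Properties of the optimistic distribution built from the empirical distribution `p`, with mass
`ε` moved to the highest outcome. -/
structure IsOptimistic {K : ℕ} (ε : ℝ) (p E : Fin K → ℝ) : Prop where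
  nonneg : ∀ j, 0 ≤ E j
  sum_eq : ∑ j, E j = 1
  sum_Iic : ∀ j : Fin K, (j : ℕ) ≠ K - 1 →
    ∑ l ∈ Finset.Iic j, E l = max 0 (∑ l ∈ Finset.Iic j, p l - ε)

theorem sum_Iic_pointMass {K : ℕ} (top j : Fin K) (h : j < top) :
    ∑ l ∈ Finset.Iic j, (if l = top then (1 : ℝ) else 0) = 0 := by
  apply Finset.sum_eq_zero
  intro l hl
  rw [if_neg]
  rintro rfl
  exact absurd (Finset.mem_Iic.1 hl) (not_le.2 h)

/-- When the top would receive mass at least 1, all lower outcomes together have mass at most ε, so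
the truncated difference vanishes below the top, as it does for the point mass. -/
theorem isOptimistic_pointMass {K : ℕ} {ε : ℝ} {p : Fin K → ℝ} (hp : p ∈ stdSimplex ℝ (Fin K))
    (top : Fin K) (htop : (top : ℕ) = K - 1) (h : 1 ≤ p top + ε) :
    IsOptimistic ε p (fun j => if j = top then 1 else 0) where
  nonneg j := by split <;> norm_num
  sum_eq := by simp
  sum_Iic j hj := by
    have hlt : j < top := by
      rw [Fin.lt_def]; have := j.2; omega
    rw [sum_Iic_pointMass top j hlt, max_eq_left]
    have h1 : ∑ l ∈ insert top (Finset.Iic j), p l ≤ 1 := by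
      rw [← hp.2]
      exact Finset.sum_le_sum_of_subset_of_nonneg (Finset.subset_univ _) fun i _ _ => hp.1 i
    rw [Finset.sum_insert (by simpa using hlt)] at h1
    linarith

/-- The new distribution is p + g + ε·1_top, where g removes total mass ε and lives on the outcomes
up to y. Below y the partial sums of p + g are 0, where those of p are at most ε; from y on, exactly
ε has been removed. -/
theorem isOptimistic_shift {K : ℕ} {ε s : ℝ} {p : Fin K → ℝ} (hp : p ∈ stdSimplex ℝ (Fin K))
    (hε : 0 ≤ ε) (top y : Fin K) (htop : (top : ℕ) = K - 1) (h : p top + ε < 1)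
    (hs : s = ∑ l ∈ Finset.Iio y, p l + p y) (hεs : ε ≤ s) (hy : ∑ l ∈ Finset.Iio y, p l ≤ ε) :
    IsOptimistic ε p
      (fun j => if j = top then p top + ε else if y < j then p j else if j = y then s - ε else 0) := by
  have hle : ∀ j : Fin K, j ≤ top := fun j => by rw [Fin.le_def]; have := j.2; omega
  have hIic : ∀ j : Fin K, Finset.Iic j = insert j (Finset.Iio j) := fun j => by
    ext l; simp [le_iff_lt_or_eq, or_comm]
  -- If y were the top, the mass strictly below it would be 1 - p top > ε, contrary to `hy`.
  have hyt : y ≠ top := by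
    rintro rfl
    have h1 : ∑ l ∈ insert y (Finset.Iio y), p l = 1 := by
      rw [← hIic, ← hp.2]
      congr 1
      ext l; simp [hle l]
    rw [Finset.sum_insert (by simp)] at h1
    linarith
  set g : Fin K → ℝ := fun l => if l < y then - p l else if l = y then s - ε - p y else 0 with hg
  have hgsum : ∀ A : Finset (Fin K), Finset.Iic y ⊆ A → ∑ l ∈ A, g l = -ε := by
    intro A hA
    rw [← Finset.sum_subset hA, hIic, Finset.sum_insert (by simp)]
    · have : ∑ l ∈ Finset.Iio y, g l = - ∑ l ∈ Finset.Iio y, p l := by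
        rw [← Finset.sum_neg_distrib]
        refine Finset.sum_congr rfl fun l hl => ?_
        simp [hg, Finset.mem_Iio.1 hl]
      rw [this]
      simp only [hg, lt_irrefl, if_false, if_true, hs]
      ring
    · intro l _ hl
      have : y < l := by simpa using hl
      simp [hg, not_lt.2 this.le, this.ne']
  have hE : ∀ j, (if j = top then p top + ε else if y < j then p j else if j = y then s - ε else 0)
      = p j + g j + if j = top then ε else 0 := by
    intro j
    by_cases hj : j = top
    · subst hj
      have : y < j := lt_of_le_of_ne (hle y) hyt
      simp [hg, not_lt.2 this.le, this.ne']
    · rcases lt_trichotomy j y with h1 | h1 | h1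
      · simp [hj, hg, h1, h1.ne, not_lt.2 h1.le]
      · subst h1; simp [hj, hg]
      · simp [hj, hg, h1, h1.ne', not_lt.2 h1.le]
  refine ⟨fun j => ?_, ?_, fun j hj => ?_⟩
  · have := hp.1 j
    have := hp.1 top
    split_ifs <;> linarith
  · simp only [hE]
    rw [Finset.sum_add_distrib, Finset.sum_add_distrib, hp.2, hgsum _ (Finset.subset_univ _)]
    simp
  · have hlt : j < top := by
      rw [Fin.lt_def]; have := j.2; omega
    simp only [hE]
    rw [Finset.sum_add_distrib, Finset.sum_add_distrib]
    have h0 : ∑ l ∈ Finset.Iic j, (if l = top then ε else 0) = 0 := by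
      apply Finset.sum_eq_zero
      intro l hl
      rw [if_neg]
      rintro rfl
      exact absurd (Finset.mem_Iic.1 hl) (not_le.2 hlt)
    rw [h0, add_zero]
    by_cases hjy : j < y
    · have h1 : ∑ l ∈ Finset.Iic j, g l = - ∑ l ∈ Finset.Iic j, p l := by
        rw [← Finset.sum_neg_distrib]
        refine Finset.sum_congr rfl fun l hl => ?_
        simp [hg, (Finset.mem_Iic.1 hl).trans_lt hjy]
      have h2 : ∑ l ∈ Finset.Iic j, p l ≤ ∑ l ∈ Finset.Iio y, p l := by
        refine Finset.sum_le_sum_of_subset_of_nonneg ?_ fun i _ _ => hp.1 i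
        intro l hl
        simpa using (Finset.mem_Iic.1 hl).trans_lt hjy
      rw [h1, max_eq_left (by linarith)]
      ring
    · push Not at hjy
      have h1 := hgsum (Finset.Iic j) (Finset.Iic_subset_Iic.2 hjy)
      have h2 : ∑ l ∈ Finset.Iic y, p l ≤ ∑ l ∈ Finset.Iic j, p l :=
        Finset.sum_le_sum_of_subset_of_nonneg (Finset.Iic_subset_Iic.2 hjy) fun i _ _ => hp.1 i
      rw [hIic y, Finset.sum_insert (by simp)] at h2
      rw [h1, max_eq_right (by linarith)]
      ring

theorem foldl_add_finRange {K : ℕ} (c : Fin K → ℕ) :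
    (List.finRange K).foldl (fun s j => s + c j) 0 = ∑ j, c j := by
  have : ∀ (l : List (Fin K)) (s : ℕ), l.foldl (fun s j => s + c j) s = s + (l.map c).sum := by
    intro l
    induction l with
    | nil => simp
    | cons a l ih => intro s; simp [ih, add_assoc]
  rw [this, zero_add, ← List.ofFn_eq_map, List.sum_ofFn]

theorem empStocDom_val_of_sum_eq_zero {K : ℕ} (hK : 0 < K) (δ : ℝ) (c : Fin K → ℕ)
    (h : ∑ j, c j = 0) :
    (empStocDom hK δ c).val =
      fun j => if j = (⟨K - 1, Nat.sub_lt hK Nat.one_pos⟩ : Fin K) then 1 else 0 := by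
  simp only [empStocDom, Timed.val_bind, Timed.val_forEach, Timed.val_op, foldl_add_finRange, h,
    if_true, Timed.val_fill, Timed.val_pure]

theorem emp_mem_stdSimplex {K : ℕ} (c : Fin K → ℕ) (h : ∑ j, c j ≠ 0) :
    (fun j => (c j : ℝ) / ((∑ j, c j : ℕ) : ℝ)) ∈ stdSimplex ℝ (Fin K) := by
  refine ⟨fun j => by positivity, ?_⟩
  rw [← Finset.sum_div, ← Nat.cast_sum, div_self]
  exact_mod_cast h

/-- The list is strictly increasing, so the part before y consists of exactly the outcomes below y.
This turns the result of the scan into a statement about the order. -/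
theorem finRange_split {K : ℕ} {l₁ l₂ : List (Fin K)} {y : Fin K}
    (h : List.finRange K = l₁ ++ y :: l₂) (p : Fin K → ℝ) :
    (l₁.map p).sum = ∑ l ∈ Finset.Iio y, p l := by
  have hs : (l₁ ++ y :: l₂).Pairwise (· < ·) := by
    rw [← h]; exact List.pairwise_lt_finRange K
  rw [List.pairwise_append, List.pairwise_cons] at hs
  obtain ⟨h1, ⟨h2, -⟩, h3⟩ := hs
  have hnd : l₁.Nodup := h1.imp fun h => h.ne
  rw [← List.sum_toFinset _ hnd]
  refine Finset.sum_congr ?_ fun _ _ => rfl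
  ext l
  simp only [List.mem_toFinset, Finset.mem_Iio]
  refine ⟨fun hl => h3 l hl y (by simp), fun hl => ?_⟩
  have hm : l ∈ l₁ ++ y :: l₂ := by rw [← h]; exact List.mem_finRange l
  rw [List.mem_append, List.mem_cons] at hm
  rcases hm with hm | rfl | hm
  · exact hm
  · exact absurd hl (lt_irrefl _)
  · exact absurd hl (h2 l hm).asymm

theorem isOptimistic_empStocDom {K : ℕ} (hK : 0 < K) (δ : ℝ) (c : Fin K → ℕ)
    (h : ∑ j, c j ≠ 0) :
    IsOptimistic (confRadius δ (∑ j, c j)) (fun j => (c j : ℝ) / ((∑ j, c j : ℕ) : ℝ))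
      (empStocDom hK δ c).val := by
  have hp := emp_mem_stdSimplex c h
  have hε := confRadius_nonneg δ (∑ j, c j)
  simp only [empStocDom, Timed.val_bind, Timed.val_forEach, Timed.val_op, foldl_add_finRange, h,
    if_false, Timed.val_fill]
  rw [← confRadius]
  set m := ∑ j, c j with hm
  set p : Fin K → ℝ := fun j => (c j : ℝ) / (m : ℝ) with hpdef
  set ε := confRadius δ m
  set top : Fin K := ⟨K - 1, Nat.sub_lt hK Nat.one_pos⟩
  change IsOptimistic ε p (Timed.val (if 1 ≤ p top + ε then _ else _))
  split_ifs with h1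
  · simpa using isOptimistic_pointMass hp top rfl h1
  · have key := foldl_firstReach p ε (List.finRange K) 0 hε
    simp only [Timed.val_bind, Timed.val_forEach, Timed.val_op, Timed.val_pure]
    set r := (List.foldl (fun (st : ℝ × Option (Fin K × ℝ)) j =>
      (st.1 + p j, if st.2.isNone ∧ ε ≤ st.1 + p j then some (j, st.1 + p j) else st.2))
      (0, none) (List.finRange K)).2 with hr
    split
    · rename_i heq
      replace heq : r = none := heq
      -- A failed search would mean that the total mass 1 is at most ε, but p top + ε < 1.
      exfalso
      simp only [heq, zero_add] at key
      rw [← List.ofFn_eq_map, List.sum_ofFn, hp.2] at key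
      have := hp.1 top
      linarith
    · rename_i y s heq
      replace heq : r = some (y, s) := heq
      simp only [heq] at key
      obtain ⟨l₁, l₂, e1, e2, e3, e4⟩ := key
      rw [finRange_split e1] at e2 e4
      simp only [zero_add] at e2 e4
      simpa using isOptimistic_shift hp hε top y rfl (not_le.1 h1) e2 e3 e4

/-! ### Stochastic dominance and closeness under concentration -/

/-- Initial segments (for `true`) and final segments (for `false`) of `Fin K`. -/
def segmentSet (K : ℕ) (b : Bool) (a : ℕ) : Finset (Fin K) :=
  Finset.univ.filter fun j => if b then (j : ℕ) ≤ a else a ≤ (j : ℕ)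

theorem segmentSet_true {K : ℕ} (j : Fin K) : segmentSet K true j = Finset.Iic j := by
  ext l
  simp only [segmentSet, Finset.mem_filter, Finset.mem_univ, true_and, if_true, Finset.mem_Iic,
    Fin.le_def]

theorem segmentSet_false {K : ℕ} (j : Fin K) : segmentSet K false j = Finset.Ici j := by
  ext l
  simp only [segmentSet, Finset.mem_filter, Finset.mem_univ, true_and, Bool.false_eq_true, if_false,
    Finset.mem_Ici, Fin.le_def]

/-- `p` is within `ε` of `D` on all initial and final segments. -/
def Concentrated {K : ℕ} (ε : ℝ) (p D : Fin K → ℝ) : Prop :=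
  ∀ b, ∀ a < K, |∑ l ∈ segmentSet K b a, p l - ∑ l ∈ segmentSet K b a, D l| ≤ ε

theorem sum_Iic_rev {K : ℕ} (p : Fin K → ℝ) (j : Fin K) :
    ∑ l ∈ Finset.Iic j, p (Fin.rev l) = ∑ l ∈ Finset.Ici (Fin.rev j), p l := by
  refine Finset.sum_equiv Fin.revPerm (fun l => ?_) fun l _ => rfl
  simp [Fin.rev_le_rev]

theorem sum_Ici_rev {K : ℕ} (p : Fin K → ℝ) (j : Fin K) :
    ∑ l ∈ Finset.Ici j, p (Fin.rev l) = ∑ l ∈ Finset.Iic (Fin.rev j), p l := by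
  refine Finset.sum_equiv Fin.revPerm (fun l => ?_) fun l _ => rfl
  simp [Fin.rev_le_rev]

theorem rev_mem_stdSimplex {K : ℕ} {D : Fin K → ℝ} (hD : D ∈ stdSimplex ℝ (Fin K)) :
    (fun j => D (Fin.rev j)) ∈ stdSimplex ℝ (Fin K) :=
  ⟨fun _ => hD.1 _, by rw [← hD.2]; exact Equiv.sum_comp Fin.revPerm D⟩

theorem Concentrated.Iic {K : ℕ} {ε : ℝ} {p D : Fin K → ℝ} (h : Concentrated ε p D) (j : Fin K) :
    |∑ l ∈ Finset.Iic j, p l - ∑ l ∈ Finset.Iic j, D l| ≤ ε := by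
  simpa only [segmentSet_true] using h true j j.2

theorem Concentrated.Ici {K : ℕ} {ε : ℝ} {p D : Fin K → ℝ} (h : Concentrated ε p D) (j : Fin K) :
    |∑ l ∈ Finset.Ici j, p l - ∑ l ∈ Finset.Ici j, D l| ≤ ε := by
  simpa only [segmentSet_false] using h false j j.2

theorem Iic_eq_univ_of_eq_pred {K : ℕ} {j : Fin K} (h : (j : ℕ) = K - 1) :
    Finset.Iic j = Finset.univ := by
  ext l
  have := l.2
  simp only [Finset.mem_Iic, Fin.le_def, Finset.mem_univ, iff_true]
  omega

/-- Lowering the distribution function by ε cancels the largest possible overestimate. At the top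
both sides are 1. -/
theorem IsOptimistic.sum_Iic_le {K : ℕ} {ε : ℝ} {p D E : Fin K → ℝ} (hE : IsOptimistic ε p E)
    (hD : D ∈ stdSimplex ℝ (Fin K))
    (h : ∀ j, |∑ l ∈ Finset.Iic j, p l - ∑ l ∈ Finset.Iic j, D l| ≤ ε) (j : Fin K) :
    ∑ l ∈ Finset.Iic j, E l ≤ ∑ l ∈ Finset.Iic j, D l := by
  by_cases hj : (j : ℕ) = K - 1
  · rw [Iic_eq_univ_of_eq_pred hj, hE.sum_eq, hD.2]
  · rw [hE.sum_Iic j hj]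
    have := abs_le.1 (h j)
    exact max_le (Finset.sum_nonneg fun i _ => hD.1 i) (by linarith)

/-- The distribution functions differ by at most 2ε, one ε from estimation and one from the shift. A
point mass is a difference of two of their values. -/
theorem IsOptimistic.abs_sub_le {K : ℕ} {ε : ℝ} {p D E : Fin K → ℝ} (hE : IsOptimistic ε p E)
    (hε : 0 ≤ ε) (hp : ∀ j, 0 ≤ p j) (hD : D ∈ stdSimplex ℝ (Fin K))
    (h : ∀ j, |∑ l ∈ Finset.Iic j, p l - ∑ l ∈ Finset.Iic j, D l| ≤ ε) (j : Fin K) :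
    |E j - D j| ≤ 4 * ε := by
  have h1 : ∀ j, |∑ l ∈ Finset.Iic j, E l - ∑ l ∈ Finset.Iic j, D l| ≤ 2 * ε := by
    intro j
    by_cases hj : (j : ℕ) = K - 1
    · rw [Iic_eq_univ_of_eq_pred hj, hE.sum_eq, hD.2]
      simpa using hε
    · rw [hE.sum_Iic j hj]
      have h2 := abs_le.1 (h j)
      have h3 : 0 ≤ ∑ l ∈ Finset.Iic j, p l := Finset.sum_nonneg fun i _ => hp i
      rw [abs_le]
      rcases max_cases 0 (∑ l ∈ Finset.Iic j, p l - ε) with ⟨h4, h5⟩ | ⟨h4, h5⟩ <;> rw [h4] <;>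
        constructor <;> linarith
  have h2 : |∑ l ∈ Finset.Iio j, E l - ∑ l ∈ Finset.Iio j, D l| ≤ 2 * ε := by
    by_cases hj : (j : ℕ) = 0
    · have : Finset.Iio j = ∅ := by
        ext l; simp [Fin.lt_def, hj]
      simpa [this] using hε
    · have : Finset.Iio j = Finset.Iic (⟨j - 1, by omega⟩ : Fin K) := by
        ext l; simp only [Finset.mem_Iio, Finset.mem_Iic, Fin.lt_def, Fin.le_def]; omega
      rw [this]; exact h1 _
  have hIic : ∀ f : Fin K → ℝ, ∑ l ∈ Finset.Iic j, f l = f j + ∑ l ∈ Finset.Iio j, f l := by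
    intro f
    rw [← Finset.sum_insert (by simp)]
    congr 1
    ext l; simp [le_iff_lt_or_eq, or_comm]
  have h3 := h1 j
  rw [hIic, hIic] at h3
  rw [abs_le] at h2 h3 ⊢
  constructor <;> linarith [h2.1, h2.2, h3.1, h3.2]

/-- Values increase strictly, so an upper level set is empty or the final segment that starts at its
least element. -/
theorem sum_upper_le_of_Ici {K : ℕ} {D E : Fin K → ℝ}
    (h : ∀ j, ∑ l ∈ Finset.Ici j, D l ≤ ∑ l ∈ Finset.Ici j, E l)
    {v : Fin K → ℝ} (hv : StrictMono v) (a : ℝ) :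
    ∑ j with a ≤ v j, D j ≤ ∑ j with a ≤ v j, E j := by
  rcases (Finset.univ.filter fun j => a ≤ v j).eq_empty_or_nonempty with h0 | h0
  · rw [h0]; simp
  · obtain ⟨y, hy, hmin⟩ := Finset.exists_min_image _ id h0
    have : (Finset.univ.filter fun j => a ≤ v j) = Finset.Ici y := by
      ext l
      simp only [Finset.mem_filter, Finset.mem_univ, true_and, Finset.mem_Ici, id] at hy hmin ⊢
      exact ⟨hmin l, fun hl => hy.trans (hv.monotone hl)⟩
    rw [this]; exact h y

theorem sum_upper_le_of_Iic {K : ℕ} {D E : Fin K → ℝ} (hDE : ∑ j, D j = ∑ j, E j)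
    (h : ∀ j, ∑ l ∈ Finset.Iic j, E l ≤ ∑ l ∈ Finset.Iic j, D l)
    {v : Fin K → ℝ} (hv : StrictMono v) (a : ℝ) :
    ∑ j with a ≤ v j, D j ≤ ∑ j with a ≤ v j, E j := by
  refine sum_upper_le_of_Ici (fun j => ?_) hv a
  have hs : ∀ f : Fin K → ℝ, ∑ l ∈ Finset.Iio j, f l + ∑ l ∈ Finset.Ici j, f l = ∑ l, f l := by
    intro f
    rw [← Finset.sum_union]
    · congr 1
      ext l; simp [lt_or_ge]
    · rw [Finset.disjoint_left]; intro l; simp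
  have h2 : ∑ l ∈ Finset.Iio j, E l ≤ ∑ l ∈ Finset.Iio j, D l := by
    by_cases hj : (j : ℕ) = 0
    · have : Finset.Iio j = ∅ := by
        ext l; simp [Fin.lt_def, hj]
      simp [this]
    · have : Finset.Iio j = Finset.Iic (⟨j - 1, by omega⟩ : Fin K) := by
        ext l; simp only [Finset.mem_Iio, Finset.mem_Iic, Fin.lt_def, Fin.le_def]; omega
      rw [this]; exact h _
  have := hs D
  have := hs E
  linarith

theorem sum_Iic_empStocDom_le {K : ℕ} (hK : 0 < K) (δ : ℝ) (c : Fin K → ℕ) {D : Fin K → ℝ}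
    (hD : D ∈ stdSimplex ℝ (Fin K))
    (h : ∑ j, c j ≠ 0 → ∀ j, |∑ l ∈ Finset.Iic j, (c l : ℝ) / ((∑ j, c j : ℕ) : ℝ) -
      ∑ l ∈ Finset.Iic j, D l| ≤ confRadius δ (∑ j, c j)) (j : Fin K) :
    ∑ l ∈ Finset.Iic j, (empStocDom hK δ c).val l ≤ ∑ l ∈ Finset.Iic j, D l := by
  by_cases hm : ∑ j, c j = 0
  · rw [empStocDom_val_of_sum_eq_zero hK δ c hm]
    by_cases hj : (j : ℕ) = K - 1
    · rw [Iic_eq_univ_of_eq_pred hj, hD.2]; simp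
    · rw [sum_Iic_pointMass]
      · exact Finset.sum_nonneg fun i _ => hD.1 i
      · rw [Fin.lt_def]; have := j.2; dsimp only; omega
  · exact (isOptimistic_empStocDom hK δ c hm).sum_Iic_le hD (h hm) j

theorem empStocDom_mem_stdSimplex {K : ℕ} (hK : 0 < K) (δ : ℝ) (c : Fin K → ℕ) :
    (empStocDom hK δ c).val ∈ stdSimplex ℝ (Fin K) := by
  by_cases hm : ∑ j, c j = 0
  · rw [empStocDom_val_of_sum_eq_zero hK δ c hm]
    exact ⟨fun j => by dsimp only; split <;> norm_num, by simp⟩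
  · have := isOptimistic_empStocDom hK δ c hm
    exact ⟨this.nonneg, this.sum_eq⟩

theorem empStocDomDown_val {K : ℕ} (hK : 0 < K) (δ : ℝ) (c : Fin K → ℕ) :
    (empStocDomDown hK δ c).val =
      fun j => (empStocDom hK δ fun l => c (Fin.rev l)).val (Fin.rev j) := by
  simp [empStocDomDown]

/-- The optimistic distribution of an item, for either orientation. -/
noncomputable def optimisticDist (up : Bool) {K : ℕ} (hK : 0 < K) (δ : ℝ) (c : Fin K → ℕ) :
    Timed (Fin K → ℝ) :=
  if up then empStocDom hK δ c else empStocDomDown hK δ c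

theorem optimisticDist_mem_stdSimplex (up : Bool) {K : ℕ} (hK : 0 < K) (δ : ℝ) (c : Fin K → ℕ) :
    (optimisticDist up hK δ c).val ∈ stdSimplex ℝ (Fin K) := by
  unfold optimisticDist
  split
  · exact empStocDom_mem_stdSimplex hK δ c
  · rw [empStocDomDown_val]
    exact rev_mem_stdSimplex (empStocDom_mem_stdSimplex hK δ _)

theorem sum_rev_nat {K : ℕ} (c : Fin K → ℕ) : ∑ j, c (Fin.rev j) = ∑ j, c j :=
  Equiv.sum_comp Fin.revPerm c

theorem sum_upper_le_optimisticDist {K : ℕ} (hK : 0 < K) (δ : ℝ) (c : Fin K → ℕ) {D : Fin K → ℝ}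
    (hD : D ∈ stdSimplex ℝ (Fin K))
    (h : ∑ j, c j ≠ 0 → Concentrated (confRadius δ (∑ j, c j))
      (fun j => (c j : ℝ) / ((∑ j, c j : ℕ) : ℝ)) D)
    {v : Fin K → ℝ} (hv : StrictMono v) (a : ℝ) :
    ∑ j with a ≤ v j, D j ≤ ∑ j with a ≤ v j, (optimisticDist true hK δ c).val j := by
  refine sum_upper_le_of_Iic ?_ (fun j => ?_) hv a
  · rw [hD.2, (optimisticDist_mem_stdSimplex true hK δ c).2]
  · exact sum_Iic_empStocDom_le hK δ c hD (fun hm j => (h hm).Iic j) j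

/-- Mirror image of the upward case: reversing the outcomes exchanges initial and final segments,
which is why `Concentrated` asks for both kinds. -/
theorem optimisticDist_sum_upper_le {K : ℕ} (hK : 0 < K) (δ : ℝ) (c : Fin K → ℕ) {D : Fin K → ℝ}
    (hD : D ∈ stdSimplex ℝ (Fin K))
    (h : ∑ j, c j ≠ 0 → Concentrated (confRadius δ (∑ j, c j))
      (fun j => (c j : ℝ) / ((∑ j, c j : ℕ) : ℝ)) D)
    {v : Fin K → ℝ} (hv : StrictMono v) (a : ℝ) :
    ∑ j with a ≤ v j, (optimisticDist false hK δ c).val j ≤ ∑ j with a ≤ v j, D j := by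
  refine sum_upper_le_of_Ici (fun j => ?_) hv a
  have := sum_Iic_empStocDom_le hK δ (fun l => c (Fin.rev l)) (rev_mem_stdSimplex hD)
    (fun hm j => ?_) (Fin.rev j)
  · simp only [optimisticDist, Bool.false_eq_true, if_false, empStocDomDown_val]
    rw [sum_Ici_rev]
    rwa [sum_Iic_rev D, Fin.rev_rev] at this
  · rw [sum_rev_nat] at hm ⊢
    have := (h hm).Ici (Fin.rev j)
    rwa [← sum_Iic_rev, ← sum_Iic_rev] at this

theorem abs_optimisticDist_sub_le (up : Bool) {K : ℕ} (hK : 0 < K) (δ : ℝ) (c : Fin K → ℕ)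
    {D : Fin K → ℝ} (hD : D ∈ stdSimplex ℝ (Fin K)) (hm : ∑ j, c j ≠ 0)
    (h : Concentrated (confRadius δ (∑ j, c j)) (fun j => (c j : ℝ) / ((∑ j, c j : ℕ) : ℝ)) D)
    (j : Fin K) :
    |(optimisticDist up hK δ c).val j - D j| ≤ 4 * confRadius δ (∑ j, c j) := by
  unfold optimisticDist
  split
  · exact (isOptimistic_empStocDom hK δ c hm).abs_sub_le (confRadius_nonneg _ _)
      (emp_mem_stdSimplex c hm).1 hD h.Iic j
  · rw [empStocDomDown_val]
    have hm' : ∑ j, c (Fin.rev j) ≠ 0 := by rwa [sum_rev_nat]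
    have := (isOptimistic_empStocDom hK δ (fun l => c (Fin.rev l)) hm').abs_sub_le
      (confRadius_nonneg _ _) (emp_mem_stdSimplex _ hm').1 (rev_mem_stdSimplex hD)
      (fun j => ?_) (Fin.rev j)
    · rwa [sum_rev_nat, Fin.rev_rev] at this
    · rw [sum_rev_nat]
      have := h.Ici (Fin.rev j)
      rwa [← sum_Iic_rev, ← sum_Iic_rev] at this

/-! ### Expectations along decision trees -/

namespace DTree

variable {n : ℕ} {k : Fin n → ℕ}

theorem run_update_of_notMem (i : Fin n) (j : Fin (k i)) (σ : DTree k) (x : ∀ i, Fin (k i))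
    (h : i ∉ (σ.run (Function.update x i j)).map Sigma.fst) :
    σ.run (Function.update x i j) = σ.run x := by
  induction σ with
  | leaf => rfl
  | probe l next ih =>
    simp only [run, List.map_cons, List.mem_cons, not_or] at h ⊢
    have hl : l ≠ i := fun e => h.1 e.symm
    rw [Function.update_of_ne hl] at h ⊢
    rw [ih _ h.2]

namespace ProbesOnce

variable {i : Fin n} {next : Fin (k i) → DTree k}

/-- Forcing outcome j at the root sends the run into branch j, and probing once then keeps item i
out of that branch. Hence the branch never reads coordinate i, whatever its value. -/
theorem run_next (h : (probe i next).ProbesOnce) (j : Fin (k i)) (x : ∀ i, Fin (k i)) :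
    (next j).run x = (next j).run (Function.update x i j) := by
  have h1 := h (Function.update x i j)
  simp only [run, List.map_cons, List.nodup_cons, Function.update_self] at h1
  exact (run_update_of_notMem i j _ x h1.1).symm

theorem run_probe (h : (probe i next).ProbesOnce) (j : Fin (k i)) (x : ∀ i, Fin (k i)) :
    (probe i next).run (Function.update x i j) = ⟨i, j⟩ :: (next j).run x := by
  rw [run_next h j x, run, Function.update_self]

theorem subtree (h : (probe i next).ProbesOnce) (j : Fin (k i)) : (next j).ProbesOnce := by
  intro x
  have h1 := h (Function.update x i j)
  rw [run_probe h, List.map_cons, List.nodup_cons] at h1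
  exact h1.2

end ProbesOnce

/-- The expectation of a function of the terminal state, computed along the tree. -/
def treeExp (D : ∀ i, Fin (k i) → ℝ) : DTree k → (State k → ℝ) → ℝ
  | leaf, g => g []
  | probe i next, g => ∑ j, D i j * treeExp D (next j) fun s => g (⟨i, j⟩ :: s)

theorem prod_update_eq (D : ∀ i, Fin (k i) → ℝ) (i : Fin n) (x : ∀ i, Fin (k i)) (j : Fin (k i)) :
    D i (x i) * ∏ l, D l (Function.update x i j l) = D i j * ∏ l, D l (x l) := by
  rw [← Finset.mul_prod_erase _ _ (Finset.mem_univ i),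
    ← Finset.mul_prod_erase _ (fun l => D l (x l)) (Finset.mem_univ i), Function.update_self]
  have : ∏ l ∈ Finset.univ.erase i, D l (Function.update x i j l) =
      ∏ l ∈ Finset.univ.erase i, D l (x l) :=
    Finset.prod_congr rfl fun l hl => by rw [Function.update_of_ne (Finset.ne_of_mem_erase hl)]
  rw [this]
  ring

/-- Resampling one coordinate does not change an expectation under a product distribution. -/
theorem sum_prod_mul_resample (D : ∀ i, Fin (k i) → ℝ) (i : Fin n) (hD : ∑ j, D i j = 1)
    (F : (∀ i, Fin (k i)) → ℝ) :
    ∑ x, (∏ l, D l (x l)) * F x =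
      ∑ j, D i j * ∑ x, (∏ l, D l (x l)) * F (Function.update x i j) := by
  simp only [Finset.mul_sum]
  rw [← Finset.sum_product']
  have h1 : ∑ x, (∏ l, D l (x l)) * F x =
      ∑ q : Fin (k i) × (∀ i, Fin (k i)), D i q.1 * ((∏ l, D l (q.2 l)) * F q.2) := by
    rw [Fintype.sum_prod_type]
    simp only [← Finset.mul_sum]
    rw [← Finset.sum_mul, hD, one_mul]
  rw [h1]
  -- Exchange the resampled value with coordinate i: an involution that preserves the weights.
  refine Finset.sum_bij' (fun q _ => (q.2 i, Function.update q.2 i q.1))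
    (fun q _ => (q.2 i, Function.update q.2 i q.1)) ?_ ?_ ?_ ?_ ?_
  · intros; simp
  · intros; simp
  · intros; simp
  · intros; simp
  · rintro ⟨j, x⟩ -
    dsimp only
    rw [Function.update_idem, Function.update_eq_self, ← mul_assoc, ← mul_assoc, prod_update_eq]

theorem sum_prod_eq_one (D : ∀ i, Fin (k i) → ℝ) (hD : ∀ i, ∑ j, D i j = 1) :
    ∑ x : ∀ i, Fin (k i), ∏ l, D l (x l) = 1 := by
  rw [← Fintype.prod_sum]
  simp [hD]

/-- Resampling the root item makes its outcome independent of the realization used below, since no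
branch probes that item again. -/
theorem sum_prod_mul_run (D : ∀ i, Fin (k i) → ℝ) (hD : ∀ i, ∑ j, D i j = 1) {σ : DTree k}
    (hσ : σ.ProbesOnce) (g : State k → ℝ) :
    ∑ x : ∀ i, Fin (k i), (∏ l, D l (x l)) * g (σ.run x) = treeExp D σ g := by
  induction σ generalizing g with
  | leaf => simp only [run, treeExp, ← Finset.sum_mul, sum_prod_eq_one D hD, one_mul]
  | probe i next ih =>
    rw [sum_prod_mul_resample D i (hD i), treeExp]
    refine Finset.sum_congr rfl fun j _ => ?_
    rw [← ih j (hσ.subtree j)]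
    simp only [hσ.run_probe]

theorem abs_treeExp_le {D : ∀ i, Fin (k i) → ℝ} (hD : ∀ i, D i ∈ stdSimplex ℝ (Fin (k i)))
    {σ : DTree k} (hσ : σ.ProbesOnce) {g : State k → ℝ} {F : ℝ}
    (hg : ∀ x, |g (σ.run x)| ≤ F) : |treeExp D σ g| ≤ F := by
  rw [← sum_prod_mul_run D (fun i => (hD i).2) hσ]
  have hnn : ∀ x : ∀ i, Fin (k i), 0 ≤ ∏ l, D l (x l) :=
    fun x => Finset.prod_nonneg fun l _ => (hD l).1 _
  calc _ ≤ ∑ x : ∀ i, Fin (k i), |(∏ l, D l (x l)) * g (σ.run x)| := Finset.abs_sum_le_sum_abs _ _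
    _ ≤ ∑ x : ∀ i, Fin (k i), (∏ l, D l (x l)) * F := by
        refine Finset.sum_le_sum fun x _ => ?_
        rw [abs_mul, abs_of_nonneg (hnn x)]
        exact mul_le_mul_of_nonneg_left (hg x) (hnn x)
    _ = F := by rw [← Finset.sum_mul, sum_prod_eq_one D fun i => (hD i).2, one_mul]

/-- Adding a constant to the function adds it to the expectation. -/
theorem treeExp_const_add {D : ∀ i, Fin (k i) → ℝ} (hD : ∀ i, ∑ j, D i j = 1) (σ : DTree k)
    (g : State k → ℝ) (a : ℝ) : treeExp D σ (fun s => a + g s) = a + treeExp D σ g := by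
  induction σ generalizing g with
  | leaf => rfl
  | probe i next ih =>
    simp only [treeExp, ih, mul_add, Finset.sum_add_distrib, ← Finset.sum_mul, hD, one_mul]

theorem treeExp_const_mul (D : ∀ i, Fin (k i) → ℝ) (σ : DTree k)
    (g : State k → ℝ) (a : ℝ) : treeExp D σ (fun s => a * g s) = a * treeExp D σ g := by
  induction σ generalizing g with
  | leaf => rfl
  | probe i next ih =>
    simp only [treeExp, ih, Finset.mul_sum]
    exact Finset.sum_congr rfl fun j _ => by ring

/-- The expected objective is stable: replacing the distribution of an item costs at most the
`ℓ¹`-distance, weighted with the probability that the item is probed. -/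
theorem abs_treeExp_sub_le {D E : ∀ i, Fin (k i) → ℝ} (hD : ∀ i, D i ∈ stdSimplex ℝ (Fin (k i)))
    (hE : ∀ i, E i ∈ stdSimplex ℝ (Fin (k i))) (hk : ∀ i, 0 < k i)
    {d : Fin n → ℝ} (hd : ∀ i, ∑ j, |E i j - D i j| ≤ d i)
    {σ : DTree k} (hσ : σ.ProbesOnce) {g : State k → ℝ} {F : ℝ}
    (hg : ∀ x, |g (σ.run x)| ≤ F) :
    |treeExp E σ g - treeExp D σ g| ≤
      F * treeExp D σ (fun s => (s.map fun o => d o.1).sum) := by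
  induction σ generalizing g with
  | leaf => simp [treeExp]
  | probe i next ih =>
    have hg' : ∀ j x, |g (⟨i, j⟩ :: (next j).run x)| ≤ F := fun j x => by
      rw [← hσ.run_probe]; exact hg _
    have hF : 0 ≤ F := (abs_nonneg _).trans (hg fun i => ⟨0, hk i⟩)
    simp only [treeExp, List.map_cons, List.sum_cons]
    simp only [treeExp_const_add fun i => (hD i).2]
    simp only [mul_add, Finset.sum_add_distrib, ← Finset.sum_mul, (hD i).2, one_mul]
    rw [Finset.mul_sum, ← Finset.sum_sub_distrib]
    -- The root is exchanged first and the subtrees afterwards, so the recursive errors are averaged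
    -- under D. Samples are drawn from D, so this is the average that can be charged to new samples.
    have hsplit : ∀ j, E i j * treeExp E (next j) (fun s => g (⟨i, j⟩ :: s)) -
        D i j * treeExp D (next j) (fun s => g (⟨i, j⟩ :: s)) =
        (E i j - D i j) * treeExp E (next j) (fun s => g (⟨i, j⟩ :: s)) +
        D i j * (treeExp E (next j) (fun s => g (⟨i, j⟩ :: s)) -
          treeExp D (next j) (fun s => g (⟨i, j⟩ :: s))) := fun j => by ring
    simp only [hsplit]
    refine (Finset.abs_sum_le_sum_abs _ _).trans ?_
    have hterm : ∀ j, |(E i j - D i j) * treeExp E (next j) (fun s => g (⟨i, j⟩ :: s)) +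
        D i j * (treeExp E (next j) (fun s => g (⟨i, j⟩ :: s)) -
          treeExp D (next j) (fun s => g (⟨i, j⟩ :: s)))| ≤
        |E i j - D i j| * F +
        F * (D i j * treeExp D (next j) (fun s => (s.map fun o => d o.1).sum)) := by
      intro j
      refine (abs_add_le _ _).trans (add_le_add ?_ ?_)
      · rw [abs_mul]
        exact mul_le_mul_of_nonneg_left (abs_treeExp_le hE (hσ.subtree j) (hg' j)) (abs_nonneg _)
      · rw [abs_mul, abs_of_nonneg ((hD i).1 j), mul_left_comm]
        exact mul_le_mul_of_nonneg_left (ih j (hσ.subtree j) (hg' j)) ((hD i).1 j)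
    refine (Finset.sum_le_sum fun j _ => hterm j).trans ?_
    rw [Finset.sum_add_distrib, ← Finset.sum_mul, ← Finset.mul_sum, mul_comm F (d i)]
    gcongr
    exact hd i

/-- The expectation of a product of factors that have mean at most one is at most one. -/
theorem treeExp_prod_le_one {D : ∀ i, Fin (k i) → ℝ} (hD : ∀ i j, 0 ≤ D i j)
    {φ : ∀ i, Fin (k i) → ℝ} (hφ : ∀ i j, 0 ≤ φ i j) (h : ∀ i, ∑ j, D i j * φ i j ≤ 1)
    (σ : DTree k) : treeExp D σ (fun s => (s.map fun o => φ o.1 o.2).prod) ≤ 1 := by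
  induction σ with
  | leaf => simp [treeExp]
  | probe i next ih =>
    simp only [treeExp, List.map_cons, List.prod_cons, treeExp_const_mul]
    refine (Finset.sum_le_sum fun j _ => ?_).trans (h i)
    rw [← mul_assoc]
    exact mul_le_of_le_one_right (mul_nonneg (hD i j) (hφ i j)) (ih j)

end DTree

/-! ### Hoeffding's lemma on a finite space -/

open MeasureTheory ProbabilityTheory in
/-- Hoeffding's lemma for the indicator of an event in a finite probability space. -/
theorem sum_mul_exp_indicator_le_one {K : ℕ} {D : Fin K → ℝ} (hD : D ∈ stdSimplex ℝ (Fin K))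
    (S : Finset (Fin K)) (t : ℝ) :
    ∑ j, D j * Real.exp (t * ((if j ∈ S then 1 else 0) - ∑ l ∈ S, D l) - t ^ 2 / 8) ≤ 1 := by
  let μ : Measure (Fin K) := ∑ j, ENNReal.ofReal (D j) • Measure.dirac j
  have hint : ∀ g : Fin K → ℝ, ∫ x, g x ∂μ = ∑ j, D j * g j := by
    intro g
    rw [integral_finsetSum_measure fun i _ => (Integrable.of_finite).smul_measure (by simp)]
    refine Finset.sum_congr rfl fun j _ => ?_
    rw [integral_smul_measure, integral_dirac, ENNReal.toReal_ofReal (hD.1 j), smul_eq_mul]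
  have hμ : IsProbabilityMeasure μ := ⟨by
    simp only [μ, Measure.finsetSum_apply, Measure.smul_apply, measure_univ, smul_eq_mul, mul_one]
    rw [← ENNReal.ofReal_sum_of_nonneg fun i _ => hD.1 i, hD.2, ENNReal.ofReal_one]⟩
  -- A variable with values in [0, 1] is sub-Gaussian with parameter 1/4, which gives the bound
  -- exp(t²/8).
  have hX := (hasSubgaussianMGF_of_mem_Icc (μ := μ) (X := fun j => if j ∈ S then (1 : ℝ) else 0)
    (a := 0) (b := 1) (measurable_of_finite _).aemeasurable
    (Filter.Eventually.of_forall fun j => by split <;> simp)).mgf_le t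
  rw [mgf, hint, hint] at hX
  have h1 : ∑ j, D j * (if j ∈ S then (1 : ℝ) else 0) = ∑ l ∈ S, D l := by simp
  rw [h1] at hX
  have h2 : ∀ j, D j * Real.exp (t * ((if j ∈ S then 1 else 0) - ∑ l ∈ S, D l) - t ^ 2 / 8)
      = D j * Real.exp (t * ((if j ∈ S then 1 else 0) - ∑ l ∈ S, D l)) * Real.exp (- (t ^ 2 / 8)) :=
    fun j => by rw [sub_eq_add_neg, Real.exp_add, mul_assoc]
  simp only [h2]
  rw [← Finset.sum_mul]
  refine (mul_le_mul_of_nonneg_right hX (Real.exp_nonneg _)).trans ?_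
  rw [← Real.exp_add]
  apply le_of_eq
  rw [Real.exp_eq_one_iff]
  norm_num
  ring

/-! ### Sample counts, remaining weight and the deviation potential -/

section Counts

variable {n : ℕ} {k : Fin n → ℕ}

/-- The counts after the outcomes in `s` have been recorded. -/
def record (c : ∀ i, Fin (k i) → ℕ) (s : State k) : ∀ i, Fin (k i) → ℕ :=
  s.foldl (fun c o =>
    Function.update c o.1 (Function.update (c o.1) o.2 (c o.1 o.2 + 1))) c

/-- A linear functional of the counts. -/
def weightSum (c : ∀ i, Fin (k i) → ℕ) (u : ∀ i, Fin (k i) → ℝ) : ℝ :=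
  ∑ i, ∑ j, (c i j : ℝ) * u i j

theorem weightSum_update (c : ∀ i, Fin (k i) → ℕ) (u : ∀ i, Fin (k i) → ℝ) (i : Fin n)
    (j : Fin (k i)) :
    weightSum (Function.update c i (Function.update (c i) j (c i j + 1))) u =
      weightSum c u + u i j := by
  unfold weightSum
  rw [← Finset.add_sum_erase _ _ (Finset.mem_univ i),
    ← Finset.add_sum_erase _ (fun l => ∑ x, (c l x : ℝ) * u l x) (Finset.mem_univ i),
    Function.update_self,
    ← Finset.add_sum_erase _ _ (Finset.mem_univ j),
    ← Finset.add_sum_erase _ (fun x => (c i x : ℝ) * u i x) (Finset.mem_univ j),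
    Function.update_self]
  have h1 : ∑ x ∈ Finset.univ.erase j,
      ((Function.update (c i) j (c i j + 1) x : ℕ) : ℝ) * u i x =
      ∑ x ∈ Finset.univ.erase j, (c i x : ℝ) * u i x :=
    Finset.sum_congr rfl fun x hx => by rw [Function.update_of_ne (Finset.ne_of_mem_erase hx)]
  have h2 : ∑ l ∈ Finset.univ.erase i, ∑ x, ((Function.update c i
      (Function.update (c i) j (c i j + 1)) l x : ℕ) : ℝ) * u l x =
      ∑ l ∈ Finset.univ.erase i, ∑ x, (c l x : ℝ) * u l x :=
    Finset.sum_congr rfl fun l hl => by rw [Function.update_of_ne (Finset.ne_of_mem_erase hl)]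
  rw [h1, h2]
  push_cast
  ring

theorem weightSum_record (c : ∀ i, Fin (k i) → ℕ) (u : ∀ i, Fin (k i) → ℝ) (s : State k) :
    weightSum (record c s) u = weightSum c u + (s.map fun o => u o.1 o.2).sum := by
  induction s generalizing c with
  | nil => simp [record]
  | cons o s ih =>
    have := ih (Function.update c o.1 (Function.update (c o.1) o.2 (c o.1 o.2 + 1)))
    rw [weightSum_update] at this
    rw [List.map_cons, List.sum_cons, ← add_assoc, ← this]
    rfl

/-- The number of samples of item `i`. -/
def samples (c : ∀ i, Fin (k i) → ℕ) (i : Fin n) : ℕ := ∑ j, c i j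

theorem samples_record (c : ∀ i, Fin (k i) → ℕ) {s : State k} (hs : (s.map Sigma.fst).Nodup)
    (i : Fin n) :
    samples (record c s) i = samples c i + if i ∈ s.map Sigma.fst then 1 else 0 := by
  -- The number of samples is a linear functional of the counts, so the general formula for
  -- recording applies.
  have hw : ∀ c : ∀ i, Fin (k i) → ℕ,
      (samples c i : ℝ) = weightSum c fun l _ => if l = i then 1 else 0 := by
    intro c
    simp only [samples, weightSum, mul_ite, mul_one, mul_zero]
    rw [Finset.sum_eq_single i (fun l _ hl => by simp [hl]) (by simp)]
    simp
  have h1 := weightSum_record c (fun l _ => if l = i then 1 else 0) s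
  rw [← hw, ← hw] at h1
  have h2 : (s.map fun o => if o.1 = i then (1 : ℝ) else 0).sum =
      if i ∈ s.map Sigma.fst then 1 else 0 := by
    have : (s.map fun o => if o.1 = i then (1 : ℝ) else 0) =
        (s.map Sigma.fst).map fun l => if l = i then (1 : ℝ) else 0 := by simp
    rw [this, ← List.sum_toFinset _ hs]
    simp
  rw [h2] at h1
  have h3 : ((samples (record c s) i : ℕ) : ℝ) =
      ((samples c i + if i ∈ s.map Sigma.fst then 1 else 0 : ℕ) : ℝ) := by
    rw [h1]; push_cast; rfl
  exact_mod_cast h3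

/-- The total of `w` over the sample numbers, up to `T`, that are still to come. -/
def remainingWeight (w : ℕ → ℝ) (T : ℕ) (c : ∀ i, Fin (k i) → ℕ) : ℝ :=
  ∑ i, ∑ m ∈ Finset.Ico (samples c i) T, w m

/-- Each probed item uses up exactly its next sample number, so the weights charged in a period are
the ones that leave the remaining sum. -/
theorem remainingWeight_record (w : ℕ → ℝ) (T : ℕ) (c : ∀ i, Fin (k i) → ℕ) {s : State k}
    (hs : (s.map Sigma.fst).Nodup) (hT : ∀ i, samples c i < T) :
    remainingWeight w T (record c s) + (s.map fun o => w (samples c o.1)).sum =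
      remainingWeight w T c := by
  have h1 : (s.map fun o => w (samples c o.1)).sum =
      ∑ i, if i ∈ s.map Sigma.fst then w (samples c i) else 0 := by
    have : (s.map fun o => w (samples c o.1)) =
        (s.map Sigma.fst).map fun l => w (samples c l) := by simp
    rw [this, ← List.sum_toFinset _ hs, ← Finset.sum_filter]
    congr 1
    ext i; simp
  rw [h1, remainingWeight, remainingWeight, ← Finset.sum_add_distrib]
  refine Finset.sum_congr rfl fun i _ => ?_
  rw [samples_record c hs]
  split
  · rw [add_comm, ← Finset.sum_eq_sum_Ico_succ_bot (hT i)]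
  · simp

/-- The increments of the exponent of the exponential supermartingale for the frequency with which
the outcome of item `i` lies in a segment. -/
noncomputable def hoeffdingWeight (D : ∀ i, Fin (k i) → ℝ) (i : Fin n) (b : Bool) (a : ℕ) (t : ℝ) :
    ∀ l, Fin (k l) → ℝ := fun l j =>
  if l = i then
    t * ((if j ∈ segmentSet (k l) b a then 1 else 0) - ∑ x ∈ segmentSet (k l) b a, D l x) - t ^ 2 / 8
  else 0

theorem sum_mul_exp_hoeffdingWeight_le_one {D : ∀ i, Fin (k i) → ℝ}
    (hD : ∀ i, D i ∈ stdSimplex ℝ (Fin (k i))) (i : Fin n) (b : Bool) (a : ℕ) (t : ℝ) (l : Fin n) :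
    ∑ j, D l j * Real.exp (hoeffdingWeight D i b a t l j) ≤ 1 := by
  unfold hoeffdingWeight
  split
  · exact sum_mul_exp_indicator_le_one (hD l) _ t
  · simp [(hD l).2]

/-- Supermartingale property over a whole period: recording multiplies the exponential by one factor
per probe, and each factor has mean at most 1. -/
theorem treeExp_exp_weightSum_record_le {D : ∀ i, Fin (k i) → ℝ} (hD : ∀ i j, 0 ≤ D i j)
    {u : ∀ i, Fin (k i) → ℝ} (hu : ∀ i, ∑ j, D i j * Real.exp (u i j) ≤ 1)
    (c : ∀ i, Fin (k i) → ℕ) (σ : DTree k) :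
    DTree.treeExp D σ (fun s => Real.exp (weightSum (record c s) u)) ≤
      Real.exp (weightSum c u) := by
  have h1 : ∀ s : State k, Real.exp (weightSum (record c s) u) =
      Real.exp (weightSum c u) * (s.map fun o => Real.exp (u o.1 o.2)).prod := by
    intro s
    rw [weightSum_record, Real.exp_add, Real.exp_list_sum, List.map_map]
    rfl
  simp only [h1, DTree.treeExp_const_mul]
  exact mul_le_of_le_one_right (Real.exp_nonneg _)
    (DTree.treeExp_prod_le_one hD (fun _ _ => Real.exp_nonneg _) hu σ)

theorem weightSum_hoeffdingWeight (D : ∀ i, Fin (k i) → ℝ) (c : ∀ i, Fin (k i) → ℕ) (i : Fin n)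
    (b : Bool) (a : ℕ) (t : ℝ) (hm : samples c i ≠ 0) :
    weightSum c (hoeffdingWeight D i b a t) = samples c i *
      (t * (∑ l ∈ segmentSet (k i) b a, (c i l : ℝ) / (samples c i : ℝ) -
        ∑ l ∈ segmentSet (k i) b a, D i l) - t ^ 2 / 8) := by
  have hm' : (samples c i : ℝ) ≠ 0 := by exact_mod_cast hm
  unfold weightSum hoeffdingWeight
  rw [Finset.sum_eq_single i (fun l _ hl => by simp [hl]) (by simp)]
  simp only [if_true]
  set P := ∑ l ∈ segmentSet (k i) b a, D i l
  have h1 : ∀ j, (c i j : ℝ) * (t * ((if j ∈ segmentSet (k i) b a then 1 else 0) - P) - t ^ 2 / 8) =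
      t * (if j ∈ segmentSet (k i) b a then (c i j : ℝ) else 0) -
        (c i j : ℝ) * (t * P + t ^ 2 / 8) := by
    intro j; split <;> ring
  simp only [h1]
  rw [Finset.sum_sub_distrib, ← Finset.sum_mul, ← Finset.mul_sum, Finset.sum_ite_mem,
    Finset.univ_inter, ← Finset.sum_div]
  have h2 : ∑ j, (c i j : ℝ) = samples c i := by simp [samples]
  rw [h2]
  field_simp
  ring

/-- The total of the exponential supermartingales for all items, segments and sample numbers. -/
noncomputable def deviationPotential (D : ∀ i, Fin (k i) → ℝ) (δ : ℝ) (K T : ℕ)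
    (c : ∀ i, Fin (k i) → ℕ) : ℝ :=
  ∑ q ∈ (Finset.univ : Finset (Fin n)) ×ˢ Finset.Icc 1 T ×ˢ (Finset.univ : Finset Bool) ×ˢ
      Finset.range K ×ˢ ({1, -1} : Finset ℤ),
    Real.exp (weightSum c
      (hoeffdingWeight D q.1 q.2.2.1 q.2.2.2.1 (q.2.2.2.2 * (4 * confRadius δ q.2.1))))

theorem deviationPotential_nonneg (D : ∀ i, Fin (k i) → ℝ) (δ : ℝ) (K T : ℕ)
    (c : ∀ i, Fin (k i) → ℕ) : 0 ≤ deviationPotential D δ K T c :=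
  Finset.sum_nonneg fun _ _ => Real.exp_nonneg _

/-- Without samples every exponent is 0, so this counts the terms; the 4 comes from two signs and
two kinds of segments. -/
theorem deviationPotential_zero (D : ∀ i, Fin (k i) → ℝ) (δ : ℝ) (K T : ℕ) :
    deviationPotential D δ K T (fun _ _ => 0) = 4 * n * K * T := by
  have h : ∀ u : ∀ i, Fin (k i) → ℝ, weightSum (fun _ _ => 0) u = 0 := by
    intro u; simp [weightSum]
  simp only [deviationPotential, h, Real.exp_zero, Finset.sum_const, Finset.card_product,
    Finset.card_univ, Fintype.card_fin, Nat.card_Icc, Finset.card_range, Fintype.card_bool]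
  rw [Finset.card_pair (by norm_num)]
  simp
  ring

theorem treeExp_finset_sum {ι : Type*} (D : ∀ i, Fin (k i) → ℝ) (σ : DTree k) (A : Finset ι)
    (g : ι → State k → ℝ) :
    DTree.treeExp D σ (fun s => ∑ q ∈ A, g q s) = ∑ q ∈ A, DTree.treeExp D σ (g q) := by
  induction σ generalizing g with
  | leaf => rfl
  | probe i next ih =>
    simp only [DTree.treeExp, ih, Finset.mul_sum]
    exact Finset.sum_comm

theorem treeExp_deviationPotential_record_le {D : ∀ i, Fin (k i) → ℝ}
    (hD : ∀ i, D i ∈ stdSimplex ℝ (Fin (k i))) (δ : ℝ) (K T : ℕ) (c : ∀ i, Fin (k i) → ℕ)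
    (σ : DTree k) :
    DTree.treeExp D σ (fun s => deviationPotential D δ K T (record c s)) ≤
      deviationPotential D δ K T c := by
  simp only [deviationPotential, treeExp_finset_sum]
  exact Finset.sum_le_sum fun q _ => treeExp_exp_weightSum_record_le (fun i => (hD i).1)
    (sum_mul_exp_hoeffdingWeight_le_one hD _ _ _ _) c σ

/-- After m samples with a deviation |d| > ε, one term with t = ±4ε has exponent m(4ε|d| - 2ε²) ≥
2mε² = log(2/δ); 4ε maximizes tε - t²/8. This t depends on m, while a supermartingale needs a fixed
t, so the potential has a term for every m up to T. -/
theorem two_div_le_deviationPotential {D : ∀ i, Fin (k i) → ℝ} {δ : ℝ} (hδ : 1 ≤ 2 / δ) {K T : ℕ}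
    (hK : ∀ i, k i ≤ K) {c : ∀ i, Fin (k i) → ℕ} (hT : ∀ i, samples c i ≤ T)
    (h : ¬ ∀ i, samples c i ≠ 0 → Concentrated (confRadius δ (samples c i))
      (fun j => (c i j : ℝ) / (samples c i : ℝ)) (D i)) :
    2 / δ ≤ deviationPotential D δ K T c := by
  simp only [Concentrated, not_forall, not_le] at h
  obtain ⟨i, hm, b, a, ha, hdev⟩ := h
  set ε := confRadius δ (samples c i) with hε
  have hε0 : 0 ≤ ε := confRadius_nonneg _ _
  have hm' : (0 : ℝ) < samples c i := by exact_mod_cast Nat.pos_of_ne_zero hm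
  have hsq : 2 * samples c i * ε ^ 2 = Real.log (2 / δ) := by
    rw [hε, confRadius, Real.sq_sqrt (div_nonneg (Real.log_nonneg hδ) (by positivity))]
    field_simp
  set d := ∑ l ∈ segmentSet (k i) b a, (c i l : ℝ) / (samples c i : ℝ) -
      ∑ l ∈ segmentSet (k i) b a, D i l with hd
  obtain ⟨z, hz, hzd⟩ : ∃ z : ℤ, z ∈ ({1, -1} : Finset ℤ) ∧ (z : ℝ) ^ 2 = 1 ∧ z * d = |d| := by
    rcases le_total 0 d with h0 | h0
    · exact ⟨1, by simp, by simp, by simp [abs_of_nonneg h0]⟩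
    · exact ⟨-1, by simp, by simp, by simp [abs_of_nonpos h0]⟩
  have hmem : (i, samples c i, b, a, z) ∈ (Finset.univ : Finset (Fin n)) ×ˢ Finset.Icc 1 T ×ˢ
      (Finset.univ : Finset Bool) ×ˢ Finset.range K ×ˢ ({1, -1} : Finset ℤ) := by
    simp only [Finset.mem_product, Finset.mem_univ, Finset.mem_Icc, Finset.mem_range, true_and]
    exact ⟨⟨Nat.pos_of_ne_zero hm, hT i⟩, ha.trans_le (hK i), hz⟩
  refine le_trans ?_ (Finset.single_le_sum (fun _ _ => Real.exp_nonneg _) hmem)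
  dsimp only
  rw [weightSum_hoeffdingWeight _ _ _ _ _ _ hm, ← hε, ← hd]
  rw [← Real.exp_log (lt_of_lt_of_le one_pos hδ), ← hsq]
  apply Real.exp_le_exp.2
  have h1 : (z : ℝ) * (4 * ε) * d - (z * (4 * ε)) ^ 2 / 8 = 4 * ε * |d| - 2 * ε ^ 2 := by
    rw [← hzd.2]
    linear_combination (- 2 * ε ^ 2) * hzd.1
  rw [h1, mul_comm 2 (_ : ℝ), mul_assoc]
  apply mul_le_mul_of_nonneg_left _ hm'.le
  nlinarith

end Counts

/-! ### Bounds for the objective and the optimum -/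

namespace ProbingInstance

variable {I : ProbingInstance}

theorem prob_nonneg {D : I.Weights} (hD : I.IsDist D) (x : I.Realization) : 0 ≤ I.prob D x :=
  Finset.prod_nonneg fun i _ => (hD i).1 _

theorem sum_prob {D : I.Weights} (hD : I.IsDist D) : ∑ x, I.prob D x = 1 :=
  DTree.sum_prod_eq_one D fun i => (hD i).2

theorem sum_prob_mul_run {D : I.Weights} (hD : I.IsDist D) {σ : DTree I.k} (hσ : σ.ProbesOnce)
    (g : State I.k → ℝ) : ∑ x, I.prob D x * g (σ.run x) = σ.treeExp D g :=
  DTree.sum_prod_mul_run D (fun i => (hD i).2) hσ g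

theorem expValue_nonneg {D : I.Weights} (hD : I.IsDist D) {σ : DTree I.k} (hσ : σ ∈ I.feasible) :
    0 ≤ I.expValue D σ :=
  Finset.sum_nonneg fun x _ => mul_nonneg (prob_nonneg hD x) (I.f_nonneg σ hσ x)

theorem expValue_le {D : I.Weights} (hD : I.IsDist D) {σ : DTree I.k} {F : ℝ}
    (hF : ∀ x, I.f (σ.run x) ≤ F) : I.expValue D σ ≤ F := by
  calc I.expValue D σ ≤ ∑ x, I.prob D x * F :=
        Finset.sum_le_sum fun x _ => mul_le_mul_of_nonneg_left (hF x) (prob_nonneg hD x)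
    _ = F := by rw [← Finset.sum_mul, sum_prob hD, one_mul]

theorem opt_nonneg (s : Sense) {D : I.Weights} (hD : I.IsDist D) : 0 ≤ I.opt s D := by
  cases s
  · exact Real.iInf_nonneg fun σ => expValue_nonneg hD σ.2
  · exact Real.iSup_nonneg fun σ => expValue_nonneg hD σ.2

theorem opt_max_le {D : I.Weights} (hD : I.IsDist D) {F : ℝ}
    (hF : ∀ σ ∈ I.feasible, ∀ x, I.f (σ.run x) ≤ F) : I.opt .max D ≤ F :=
  have : Nonempty I.feasible := I.feasible_nonempty.to_subtype
  ciSup_le fun σ => expValue_le hD (hF σ.1 σ.2)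

theorem bound_nonneg {F : ℝ} (hF : ∀ σ ∈ I.feasible, ∀ x, I.f (σ.run x) ≤ F) : 0 ≤ F := by
  obtain ⟨σ, hσ⟩ := I.feasible_nonempty
  let x : I.Realization := fun i => ⟨0, I.k_pos i⟩
  exact (I.f_nonneg σ hσ x).trans (hF σ hσ x)

end ProbingInstance

/-- `1` for minimization, `-1` for maximization. -/
def Sense.sign : Sense → ℝ
  | .min => 1
  | .max => -1

theorem Sense.abs_sign (s : Sense) : |s.sign| = 1 := by cases s <;> simp [sign]

/-! ### Recursion over the periods -/

namespace Learner

variable {I : ProbingInstance} (L : Learner I)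

/-- Expected total objective over `R` periods, starting from memory `μ`. -/
def expTotalFrom (D : I.Weights) (R : ℕ) (μ : L.Mem) : ℝ :=
  ∑ h : Fin R → I.Realization, (∏ t, I.prob D (h t)) * L.totalFrom μ (List.ofFn h)

theorem regret_eq (s : Sense) (α : ℝ) (D : I.Weights) (T : ℕ) :
    L.regret s α D T =
      s.sign * L.expTotalFrom D T L.start.val - T * (s.sign * (α * I.opt s D)) := by
  cases s <;> simp only [regret, expTotal, expTotalFrom, Sense.sign] <;> ring

theorem expTotalFrom_zero (D : I.Weights) (μ : L.Mem) : L.expTotalFrom D 0 μ = 0 := by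
  simp [expTotalFrom, totalFrom]

/-- Condition on the first realization: the policy depends on the memory alone, and the later
realizations are independent of the first. -/
theorem expTotalFrom_succ {D : I.Weights} (hD : I.IsDist D) (R : ℕ) (μ : L.Mem) :
    L.expTotalFrom D (R + 1) μ = I.expValue D (L.select μ).val.tree +
      ∑ x, I.prob D x * L.expTotalFrom D R
        (L.observe μ ((L.select μ).val.tree.run x)).val := by
  have hone : ∑ h : Fin R → I.Realization, ∏ t, I.prob D (h t) = 1 := by
    rw [← Fintype.prod_sum]
    simp [ProbingInstance.sum_prob hD]
  unfold expTotalFrom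
  rw [← (Fin.consEquiv fun _ : Fin (R + 1) => I.Realization).sum_comp, Fintype.sum_prod_type,
    ProbingInstance.expValue, ← Finset.sum_add_distrib]
  refine Finset.sum_congr rfl fun x _ => ?_
  have : ∀ h : Fin R → I.Realization,
      (∏ t, I.prob D ((Fin.consEquiv fun _ : Fin (R + 1) => I.Realization) (x, h) t)) *
        L.totalFrom μ (List.ofFn ((Fin.consEquiv fun _ : Fin (R + 1) => I.Realization) (x, h))) =
      I.prob D x * I.f ((L.select μ).val.tree.run x) * (∏ t, I.prob D (h t)) +
      I.prob D x * ((∏ t, I.prob D (h t)) *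
        L.totalFrom (L.observe μ ((L.select μ).val.tree.run x)).val (List.ofFn h)) := by
    intro h
    rw [Fin.prod_univ_succ, List.ofFn_succ]
    simp only [Fin.consEquiv_apply, Fin.cons_zero, Fin.cons_succ, totalFrom]
    ring
  simp only [this]
  rw [Finset.sum_add_distrib, ← Finset.mul_sum, hone, mul_one, ← Finset.mul_sum]

/-- A potential function argument for the expected total objective. -/
theorem mul_expTotalFrom_le {D : I.Weights} (hD : I.IsDist D) (a : ℝ) (Inv : ℕ → L.Mem → Prop)
    (Φ : ℕ → L.Mem → ℝ) (h0 : ∀ μ, 0 ≤ Φ 0 μ)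
    (hInv : ∀ R μ, Inv (R + 1) μ → ∀ x, Inv R (L.observe μ ((L.select μ).val.tree.run x)).val)
    (hstep : ∀ R μ, Inv (R + 1) μ → a * I.expValue D (L.select μ).val.tree +
      ∑ x, I.prob D x * Φ R (L.observe μ ((L.select μ).val.tree.run x)).val ≤ Φ (R + 1) μ)
    (R : ℕ) (μ : L.Mem) (hμ : Inv R μ) : a * L.expTotalFrom D R μ ≤ Φ R μ := by
  induction R generalizing μ with
  | zero => simpa [expTotalFrom_zero] using h0 μ
  | succ R ih =>
    refine le_trans ?_ (hstep R μ hμ)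
    rw [expTotalFrom_succ L hD, mul_add, Finset.mul_sum]
    refine add_le_add le_rfl (Finset.sum_le_sum fun x _ => ?_)
    rw [mul_left_comm]
    exact mul_le_mul_of_nonneg_left (ih _ (hInv R μ hμ x)) (ProbingInstance.prob_nonneg hD x)

end Learner

/-! ### Regret of one period and the potential argument -/

section Online

variable (P : Problem) (M : Monotonicity) (ALG : OfflineAlgorithm) (I : ProbingInstance) (T : ℕ)

/-- The parameter `δ` of the optimistic algorithm. -/
noncomputable def confParam (n T : ℕ) : ℝ := 2 / ((n : ℝ) * T * (n * T) * (n * T))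

/-- The optimistic distributions for the counts `c`. -/
noncomputable def optimisticWeights (c : ∀ i, Fin (I.k i) → ℕ) : I.Weights := fun i =>
  (optimisticDist (optimisticUp P.sense M) (I.k_pos i) (confParam I.n T) (c i)).val

theorem isDist_optimisticWeights (c : ∀ i, Fin (I.k i) → ℕ) :
    I.IsDist (optimisticWeights P M I T c) := fun _ => optimisticDist_mem_stdSimplex _ _ _ _

theorem onlineToOffline_select_val (c : ∀ i, Fin (I.k i) → ℕ) :
    ((onlineToOffline P M ALG I T).select c).val = (ALG I (optimisticWeights P M I T c)).val := by
  simp only [onlineToOffline, Timed.val_bind, Timed.val_op, Timed.val_fill]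
  rfl

theorem onlineToOffline_observe_val (c : ∀ i, Fin (I.k i) → ℕ) (s : State I.k) :
    ((onlineToOffline P M ALG I T).observe c s).val = record c s := by
  simp only [onlineToOffline, Timed.val_forEach]
  rfl

theorem onlineToOffline_start_val :
    (onlineToOffline P M ALG I T).start.val = fun _ _ => 0 := by
  simp only [onlineToOffline, Timed.val_fill, Timed.val_op]

variable {P M ALG I T} {α : ℝ}

theorem two_div_confParam (n T : ℕ) : 2 / confParam n T = ((n : ℝ) * T) ^ 3 := by
  rw [confParam, div_div_cancel₀ two_ne_zero]
  ring

/-- The optimal value for the optimistic distributions is no worse than the true one if all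
empirical frequencies are accurate. -/
theorem sign_mul_opt_optimisticWeights_le (hM : P.IsMonotone M) (hI : I ∈ P.instances)
    {D : I.Weights} (hD : I.IsDist D) {c : ∀ i, Fin (I.k i) → ℕ}
    (hc : ∀ i, samples c i ≠ 0 → Concentrated (confRadius (confParam I.n T) (samples c i))
      (fun j => (c i j : ℝ) / (samples c i : ℝ)) (D i)) :
    P.sense.sign * I.opt P.sense (optimisticWeights P M I T c) ≤
      P.sense.sign * I.opt P.sense D := by
  have hE := isDist_optimisticWeights P M I T c
  have hup : optimisticUp P.sense M = true → I.Dominates (optimisticWeights P M I T c) D := by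
    intro h i a
    simp only [optimisticWeights, h]
    exact sum_upper_le_optimisticDist (I.k_pos i) _ (c i) (hD i) (hc i) (I.value_strictMono i) a
  have hdown : optimisticUp P.sense M = false → I.Dominates D (optimisticWeights P M I T c) := by
    intro h i a
    simp only [optimisticWeights, h]
    exact optimisticDist_sum_upper_le (I.k_pos i) _ (c i) (hD i) (hc i) (I.value_strictMono i) a
  rcases hs : P.sense with _ | _ <;> cases M <;>
    simp only [Problem.IsMonotone, hs, optimisticUp, Sense.sign, true_implies, one_mul, neg_mul,
      neg_le_neg_iff] at hM hup hdown ⊢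
  · exact hM I hI D _ hD hE hup
  · exact hM I hI _ D hE hD hdown
  · exact hM I hI _ D hE hD hdown
  · exact hM I hI D _ hD hE hup

theorem Problem.IsApproximation.feasible (h : P.IsApproximation α ALG) (hI : I ∈ P.instances)
    {D : I.Weights} (hD : I.IsDist D) : (ALG I D).val.tree ∈ I.feasible :=
  (h.2 I hI D hD).1

theorem Problem.IsApproximation.nonneg (h : P.IsApproximation α ALG) : 0 ≤ α := by
  have := h.1
  rcases hs : P.sense with _ | _ <;> simp only [hs] at this
  · linarith
  · exact this.1.le

theorem Problem.IsApproximation.sign_mul_expValue_le (h : P.IsApproximation α ALG)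
    (hI : I ∈ P.instances) {D : I.Weights} (hD : I.IsDist D) :
    P.sense.sign * I.expValue D (ALG I D).val.tree ≤ P.sense.sign * (α * I.opt P.sense D) := by
  have := (h.2 I hI D hD).2
  rcases hs : P.sense with _ | _ <;> simp only [hs, Sense.sign] at this ⊢ <;> linarith

/-- The regret of a single period is at most the largest value of the objective. -/
theorem Problem.IsApproximation.sign_mul_expValue_sub_le (h : P.IsApproximation α ALG)
    {D : I.Weights} (hD : I.IsDist D) {σ : DTree I.k} (hσ : σ ∈ I.feasible) {F : ℝ}
    (hF : ∀ σ ∈ I.feasible, ∀ x, I.f (σ.run x) ≤ F) :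
    P.sense.sign * I.expValue D σ ≤ P.sense.sign * (α * I.opt P.sense D) + F := by
  have h1 := ProbingInstance.expValue_nonneg hD hσ
  have h2 := ProbingInstance.expValue_le hD (hF σ hσ)
  have h3 := ProbingInstance.opt_nonneg P.sense hD
  have h4 := mul_nonneg h.nonneg h3
  have h5 := h.1
  -- For minimization, the cost is at most F and α·OPT ≥ 0. For maximization, the value is
  -- nonnegative and α·OPT ≤ OPT ≤ F.
  rcases hs : P.sense with _ | _ <;> simp only [hs, Sense.sign] at h3 h4 h5 ⊢
  · linarith
  · have h6 := ProbingInstance.opt_max_le hD hF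
    have h7 := mul_le_of_le_one_left h3 h5.2
    linarith

/-- A bound for the `ℓ¹`-distance of the optimistic distribution from the true one. -/
noncomputable def distBound (δ : ℝ) (K m : ℕ) : ℝ := if m = 0 then 2 else K * (4 * confRadius δ m)

theorem distBound_nonneg (δ : ℝ) (K m : ℕ) : 0 ≤ distBound δ K m := by
  unfold distBound
  split
  · norm_num
  · have := confRadius_nonneg δ m
    positivity

theorem le_maxSupport (i : Fin I.n) : I.k i ≤ I.maxSupport :=
  Finset.le_sup (f := I.k) (Finset.mem_univ i)

theorem sum_abs_optimisticWeights_sub_le {D : I.Weights} (hD : I.IsDist D)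
    {c : ∀ i, Fin (I.k i) → ℕ} (i : Fin I.n)
    (hc : samples c i ≠ 0 → Concentrated (confRadius (confParam I.n T) (samples c i))
      (fun j => (c i j : ℝ) / (samples c i : ℝ)) (D i)) :
    ∑ j, |optimisticWeights P M I T c i j - D i j| ≤
      distBound (confParam I.n T) I.maxSupport (samples c i) := by
  have hE := isDist_optimisticWeights P M I T c i
  unfold distBound
  split_ifs with hm
  · calc ∑ j, |optimisticWeights P M I T c i j - D i j|
        ≤ ∑ j, (optimisticWeights P M I T c i j + D i j) := by
          refine Finset.sum_le_sum fun j _ => ?_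
          have h1 := hE.1 j
          have h2 := (hD i).1 j
          rw [abs_le]
          constructor <;> linarith
      _ = 2 := by rw [Finset.sum_add_distrib, hE.2, (hD i).2]; norm_num
  · have hε := confRadius_nonneg (confParam I.n T) (samples c i)
    calc ∑ j, |optimisticWeights P M I T c i j - D i j|
        ≤ ∑ _j : Fin (I.k i), 4 * confRadius (confParam I.n T) (samples c i) :=
          Finset.sum_le_sum fun j _ => abs_optimisticDist_sub_le _ _ _ _ (hD i) hm (hc hm) j
      _ = I.k i * (4 * confRadius (confParam I.n T) (samples c i)) := by simp
      _ ≤ _ := by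
        gcongr
        exact le_maxSupport i

theorem treeExp_nonneg {n : ℕ} {k : Fin n → ℕ} {D : ∀ i, Fin (k i) → ℝ} (hD : ∀ i j, 0 ≤ D i j)
    (σ : DTree k) {g : State k → ℝ} (hg : ∀ s, 0 ≤ g s) : 0 ≤ DTree.treeExp D σ g := by
  induction σ generalizing g with
  | leaf => exact hg _
  | probe i next ih =>
    exact Finset.sum_nonneg fun j _ => mul_nonneg (hD i j) (ih j fun s => hg _)

/-- The regret of a single period, in terms of the samples available. -/
theorem period_regret_le (hM : P.IsMonotone M) (hA : P.IsApproximation α ALG)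
    (hI : I ∈ P.instances) (hT : 1 ≤ I.n * T) {D : I.Weights} (hD : I.IsDist D) {F : ℝ}
    (hF : ∀ σ ∈ I.feasible, ∀ x, I.f (σ.run x) ≤ F) {c : ∀ i, Fin (I.k i) → ℕ}
    (hc : ∀ i, samples c i ≤ T) :
    P.sense.sign * I.expValue D (ALG I (optimisticWeights P M I T c)).val.tree ≤
      P.sense.sign * (α * I.opt P.sense D) +
      F * ((ALG I (optimisticWeights P M I T c)).val.tree.treeExp D
        (fun s => (s.map fun o =>
          distBound (confParam I.n T) I.maxSupport (samples c o.1)).sum) +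
        deviationPotential D (confParam I.n T) I.maxSupport T c / ((I.n : ℝ) * T) ^ 3) := by
  have hE := isDist_optimisticWeights P M I T c
  set E := optimisticWeights P M I T c with hEdef
  have hσ := hA.feasible hI hE
  set σ := (ALG I E).val.tree
  have hF0 := ProbingInstance.bound_nonneg hF
  have hN : (1 : ℝ) ≤ ((I.n : ℝ) * T) ^ 3 := one_le_pow₀ (by exact_mod_cast hT)
  have hΨ := deviationPotential_nonneg D (confParam I.n T) I.maxSupport T c
  have hQ : 0 ≤ σ.treeExp D (fun s => (s.map fun o =>
      distBound (confParam I.n T) I.maxSupport (samples c o.1)).sum) :=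
    treeExp_nonneg (fun i => (hD i).1) σ fun s => List.sum_nonneg fun z hz => by
      obtain ⟨o, -, rfl⟩ := List.mem_map.1 hz
      exact distBound_nonneg _ _ _
  -- Accuracy is a property of the current counts, so the case distinction is deterministic.
  by_cases hgood : ∀ i, samples c i ≠ 0 → Concentrated (confRadius (confParam I.n T) (samples c i))
      (fun j => (c i j : ℝ) / (samples c i : ℝ)) (D i)
  · have h1 := sign_mul_opt_optimisticWeights_le hM hI hD hgood
    rw [← hEdef] at h1
    have h2 := hA.sign_mul_expValue_le hI hE
    have h3 := DTree.abs_treeExp_sub_le hD hE I.k_pos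
      (fun i => sum_abs_optimisticWeights_sub_le hD i (hgood i))
      (I.feasible_probesOnce σ hσ) (g := I.f) (F := F) fun x => by
        rw [abs_of_nonneg (I.f_nonneg σ hσ x)]; exact hF σ hσ x
    rw [← ProbingInstance.sum_prob_mul_run hE (I.feasible_probesOnce σ hσ),
      ← ProbingInstance.sum_prob_mul_run hD (I.feasible_probesOnce σ hσ) I.f] at h3
    change |I.expValue E σ - I.expValue D σ| ≤ _ at h3
    have h4 : P.sense.sign * I.expValue D σ - P.sense.sign * I.expValue E σ ≤
        |I.expValue E σ - I.expValue D σ| := by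
      rw [← mul_sub]
      refine (le_abs_self _).trans ?_
      rw [abs_mul, Sense.abs_sign, one_mul, abs_sub_comm]
    have h5 := mul_le_mul_of_nonneg_left h1 hA.nonneg
    have h6 : 0 ≤ F * (deviationPotential D (confParam I.n T) I.maxSupport T c /
      ((I.n : ℝ) * T) ^ 3) := by positivity
    rw [mul_add]
    rw [mul_left_comm, mul_left_comm α] at h5
    linarith
  · have h1 := hA.sign_mul_expValue_sub_le hD hσ hF
    have h2 := two_div_le_deviationPotential (by rw [two_div_confParam]; exact hN)
      (le_maxSupport (I := I)) hc hgood
    rw [two_div_confParam] at h2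
    -- At an inaccurate state the scaled potential alone pays for the trivial loss F.
    have h3 : 1 ≤ deviationPotential D (confParam I.n T) I.maxSupport T c /
        ((I.n : ℝ) * T) ^ 3 := (one_le_div (by linarith)).2 h2
    have h4 : F * 1 ≤ F * (σ.treeExp D (fun s => (s.map fun o =>
      distBound (confParam I.n T) I.maxSupport (samples c o.1)).sum) +
        deviationPotential D (confParam I.n T) I.maxSupport T c / ((I.n : ℝ) * T) ^ 3) :=
      mul_le_mul_of_nonneg_left (by linarith) hF0
    linarith

/-- The potential is the benchmark for R periods, plus F times the error weights still to be charged
and R times the scaled deviation potential. The condition on `samples c i + R` keeps sample numbers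
below T while periods remain, so every charge has a weight to draw on. -/
theorem sign_mul_expTotalFrom_le (hM : P.IsMonotone M) (hA : P.IsApproximation α ALG)
    (hI : I ∈ P.instances) (hT : 1 ≤ I.n * T) {D : I.Weights} (hD : I.IsDist D) {F : ℝ}
    (hF : ∀ σ ∈ I.feasible, ∀ x, I.f (σ.run x) ≤ F) (R : ℕ) (c : ∀ i, Fin (I.k i) → ℕ)
    (hc : ∀ i, samples c i + R ≤ T) :
    P.sense.sign * (onlineToOffline P M ALG I T).expTotalFrom D R c ≤
      R * (P.sense.sign * (α * I.opt P.sense D)) +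
      F * (remainingWeight (distBound (confParam I.n T) I.maxSupport) T c +
        R * (deviationPotential D (confParam I.n T) I.maxSupport T c / ((I.n : ℝ) * T) ^ 3)) := by
  have hF0 := ProbingInstance.bound_nonneg hF
  have hσ : ∀ c : ∀ i, Fin (I.k i) → ℕ,
      (ALG I (optimisticWeights P M I T c)).val.tree.ProbesOnce := fun c =>
    I.feasible_probesOnce _ (hA.feasible hI (isDist_optimisticWeights P M I T c))
  refine (onlineToOffline P M ALG I T).mul_expTotalFrom_le hD P.sense.sign
    (fun R (c : ∀ i, Fin (I.k i) → ℕ) => ∀ i, samples c i + R ≤ T)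
    (fun R (c : ∀ i, Fin (I.k i) → ℕ) => R * (P.sense.sign * (α * I.opt P.sense D)) +
      F * (remainingWeight (distBound (confParam I.n T) I.maxSupport) T c +
        R * (deviationPotential D (confParam I.n T) I.maxSupport T c / ((I.n : ℝ) * T) ^ 3)))
    ?_ ?_ ?_ R c hc
  · intro c
    have : 0 ≤ remainingWeight (distBound (confParam I.n T) I.maxSupport) T c :=
      Finset.sum_nonneg fun i _ => Finset.sum_nonneg fun m _ => distBound_nonneg _ _ _
    simp only [Nat.cast_zero, zero_mul, add_zero, zero_add]
    positivity
  · intro R (c : ∀ i, Fin (I.k i) → ℕ) h x i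
    rw [onlineToOffline_observe_val, onlineToOffline_select_val, samples_record c (hσ c x)]
    have := h i
    split <;> omega
  · intro R (c : ∀ i, Fin (I.k i) → ℕ) h
    simp only [onlineToOffline_observe_val, onlineToOffline_select_val]
    have h1 := period_regret_le hM hA hI hT hD hF (c := c) fun i => by have := h i; omega
    have hσc := hσ c
    set σ := (ALG I (optimisticWeights P M I T c)).val.tree
    set w := distBound (confParam I.n T) I.maxSupport
    set N := ((I.n : ℝ) * T) ^ 3
    set o := P.sense.sign * (α * I.opt P.sense D)
    -- The expected drop of the remaining weight is exactly the error term in the regret of this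
    -- period.
    have h2 : ∑ x, I.prob D x * remainingWeight w T (record c (σ.run x)) =
        remainingWeight w T c -
          σ.treeExp D (fun s => (s.map fun o => w (samples c o.1)).sum) := by
      rw [← ProbingInstance.sum_prob_mul_run hD hσc, eq_sub_iff_add_eq, ← Finset.sum_add_distrib]
      have : ∀ x, I.prob D x * remainingWeight w T (record c (σ.run x)) +
          I.prob D x * ((σ.run x).map fun o => w (samples c o.1)).sum =
          I.prob D x * remainingWeight w T c := by
        intro x
        rw [← mul_add, remainingWeight_record w T c (hσc x) fun i => by have := h i; omega]
      simp only [this]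
      rw [← Finset.sum_mul, ProbingInstance.sum_prob hD, one_mul]
    have h3 := treeExp_deviationPotential_record_le hD (confParam I.n T) I.maxSupport T c σ
    rw [← ProbingInstance.sum_prob_mul_run hD hσc] at h3
    set Ψ := deviationPotential D (confParam I.n T) I.maxSupport T
    have h4 : ∑ x, I.prob D x * (R * o + F * (remainingWeight w T (record c (σ.run x)) +
        R * (Ψ (record c (σ.run x)) / N))) = R * o +
        F * (∑ x, I.prob D x * remainingWeight w T (record c (σ.run x)) +
          R * ((∑ x, I.prob D x * Ψ (record c (σ.run x))) / N)) := by
      have : ∀ x, I.prob D x * (R * o + F * (remainingWeight w T (record c (σ.run x)) +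
        R * (Ψ (record c (σ.run x)) / N))) = I.prob D x * (R * o) +
          (F * (I.prob D x * remainingWeight w T (record c (σ.run x))) +
          (F * R / N) * (I.prob D x * Ψ (record c (σ.run x)))) := fun x => by ring
      simp only [this]
      rw [Finset.sum_add_distrib, Finset.sum_add_distrib, ← Finset.sum_mul,
        ProbingInstance.sum_prob hD, ← Finset.mul_sum, ← Finset.mul_sum]
      ring
    rw [h4, h2]
    have h5 : F * (R * ((∑ x, I.prob D x * Ψ (record c (σ.run x))) / N)) ≤
        F * (R * (Ψ c / N)) := by gcongr
    push_cast
    simp only [mul_add, mul_sub, add_mul, one_mul] at h1 ⊢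
    linarith

end Online

/-! ### Summing the confidence radii -/

section RegretBound

theorem sum_sqrt_div_succ_le {c : ℝ} (hc : 0 ≤ c) (T : ℕ) :
    ∑ m ∈ Finset.range T, Real.sqrt (c / ((m + 1 : ℕ) : ℝ)) ≤ 2 * Real.sqrt (c * T) := by
  induction T with
  | zero => simp
  | succ T ih =>
    rw [Finset.sum_range_succ]
    refine (add_le_add_left ih _).trans ?_
    rw [Real.sqrt_div hc, Real.sqrt_mul hc, Real.sqrt_mul hc]
    set a := Real.sqrt T
    set b := Real.sqrt ((T + 1 : ℕ) : ℝ)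
    have hb : 0 < b := Real.sqrt_pos.2 (by positivity)
    have hab : b ^ 2 = a ^ 2 + 1 := by
      rw [Real.sq_sqrt (by positivity), Real.sq_sqrt (by positivity)]; push_cast; ring
    -- Multiplied by b this is 2ab + 1 ≤ 2b², which follows from 2ab ≤ a² + b² and b² = a² + 1.
    have h1 : 2 * a + 1 / b ≤ 2 * b := by
      rw [← mul_le_mul_iff_left₀ hb, add_mul, one_div, inv_mul_cancel₀ hb.ne']
      nlinarith [sq_nonneg (a - b)]
    have h2 := mul_le_mul_of_nonneg_left h1 (Real.sqrt_nonneg c)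
    calc _ = Real.sqrt c * (2 * a + 1 / b) := by ring
      _ ≤ _ := h2
      _ = _ := by ring

theorem sum_distBound_le {n K T : ℕ} (hT : 1 ≤ T) (hn : 1 ≤ n) :
    ∑ m ∈ Finset.range T, distBound (confParam n T) K m ≤
      2 + 16 * K * Real.sqrt (T * Real.log (n * T)) := by
  obtain ⟨S, rfl⟩ : ∃ S, T = S + 1 := ⟨T - 1, by omega⟩
  have hlog : 0 ≤ Real.log (n * ((S + 1 : ℕ) : ℝ)) := by
    apply Real.log_nonneg
    exact_mod_cast Nat.mul_pos hn hT
  rw [Finset.sum_range_succ']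
  -- Since 2/δ = (nT)³, the squared radius is 3 log(nT) / (2m).
  set c := 3 / 2 * Real.log (n * ((S + 1 : ℕ) : ℝ)) with hc
  have h1 : ∀ m, distBound (confParam n (S + 1)) K (m + 1) =
      4 * K * Real.sqrt (c / ((m + 1 : ℕ) : ℝ)) := by
    intro m
    rw [distBound, if_neg (Nat.succ_ne_zero m), confRadius, two_div_confParam, Real.log_pow, hc]
    have : ((3 : ℕ) : ℝ) * Real.log (n * ((S + 1 : ℕ) : ℝ)) / (2 * ((m + 1 : ℕ) : ℝ)) =
      3 / 2 * Real.log (n * ((S + 1 : ℕ) : ℝ)) / ((m + 1 : ℕ) : ℝ) := by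
      push_cast
      field_simp
    rw [this]
    ring
  simp only [h1]
  rw [← Finset.mul_sum]
  -- The 16 is 4 from the pointwise error, 2 from the sum of inverse square roots, and 2 as a bound
  -- for √(3/2).
  have h2 := sum_sqrt_div_succ_le (c := c) (by positivity) S
  have h3 : Real.sqrt (c * S) ≤ 2 * Real.sqrt (((S + 1 : ℕ) : ℝ) * Real.log (n * ((S + 1 : ℕ) : ℝ))) := by
    rw [← Real.sqrt_sq (zero_le_two (α := ℝ)), ← Real.sqrt_mul (by positivity)]
    apply Real.sqrt_le_sqrt
    rw [hc]
    push_cast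
    push_cast at hlog
    nlinarith [mul_nonneg hlog (Nat.cast_nonneg (α := ℝ) S)]
  have h4 : (0 : ℝ) ≤ 4 * K := by positivity
  have h5 := mul_le_mul_of_nonneg_left (h2.trans (mul_le_mul_of_nonneg_left h3 zero_le_two)) h4
  simp only [distBound, if_true]
  linarith

/-- Needed to absorb terms without the square root; log 2 > 1/4 suffices. -/
theorem half_le_sqrt_mul_log {n T : ℕ} (hT : 1 ≤ T) (h : 2 ≤ n * T) :
    1 / 2 ≤ Real.sqrt (T * Real.log (n * T)) := by
  apply Real.le_sqrt_of_sq_le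
  have h1 : Real.log 2 ≤ Real.log ((n : ℝ) * T) :=
    Real.log_le_log two_pos (by exact_mod_cast h)
  have h2 := Real.log_two_gt_d9
  have h3 : (1 : ℝ) ≤ T := by exact_mod_cast hT
  nlinarith

variable {P : Problem} {M : Monotonicity} {ALG : OfflineAlgorithm} {I : ProbingInstance} {T : ℕ}
  {α : ℝ}

theorem one_le_maxSupport (hn : 1 ≤ I.n) : 1 ≤ I.maxSupport :=
  (I.k_pos ⟨0, hn⟩).trans_le (le_maxSupport _)

theorem regret_onlineToOffline_le (hM : P.IsMonotone M) (hA : P.IsApproximation α ALG)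
    (hI : I ∈ P.instances) (hT : 2 ≤ I.n * T) {D : I.Weights} (hD : I.IsDist D) {F : ℝ}
    (hF : ∀ σ ∈ I.feasible, ∀ x, I.f (σ.run x) ≤ F) :
    (onlineToOffline P M ALG I T).regret P.sense α D T ≤
      28 * I.n * I.maxSupport * F * Real.sqrt (T * Real.log (I.n * T)) := by
  have hn : 1 ≤ I.n := by by_contra! h; simp [Nat.lt_one_iff.1 h] at hT
  have hT1 : 1 ≤ T := by by_contra! h; simp [Nat.lt_one_iff.1 h] at hT
  have hF0 := ProbingInstance.bound_nonneg hF
  have h0 : ∀ i : Fin I.n, samples (fun i (_ : Fin (I.k i)) => 0) i = 0 := fun i => by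
    simp [samples]
  have h1 := sign_mul_expTotalFrom_le hM hA hI (one_le_two.trans hT) hD hF T
    (fun _ _ => 0) fun i => by rw [h0, zero_add]
  rw [Learner.regret_eq, onlineToOffline_start_val, sub_le_iff_le_add']
  refine h1.trans (add_le_add le_rfl ?_)
  rw [deviationPotential_zero, remainingWeight]
  simp only [h0, Nat.Ico_zero_eq_range, Finset.sum_const, Finset.card_univ, Fintype.card_fin,
    nsmul_eq_mul]
  have hK : (1 : ℝ) ≤ I.maxSupport := by exact_mod_cast one_le_maxSupport hn
  have hn' : (1 : ℝ) ≤ I.n := by exact_mod_cast hn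
  have hT' : (1 : ℝ) ≤ T := by exact_mod_cast hT1
  have h2 := sum_distBound_le (K := I.maxSupport) hT1 hn
  have h3 := half_le_sqrt_mul_log hT1 hT
  set X := Real.sqrt (T * Real.log (I.n * T))
  set n : ℝ := (I.n : ℝ)
  set K : ℝ := (I.maxSupport : ℝ)
  set t : ℝ := (T : ℝ)
  have h4 : t * (4 * n * K * t / (n * t) ^ 3) ≤ 4 * n * K := by
    rw [← mul_div_assoc, div_le_iff₀ (by positivity)]
    -- One factor t comes from the periods and one from the sample numbers in the potential.
    have h5 : t ^ 2 ≤ (n * t) ^ 3 :=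
      calc t ^ 2 ≤ t ^ 3 := pow_le_pow_right₀ hT' (by norm_num)
        _ ≤ (n * t) ^ 3 := by gcongr; nlinarith
    have h6 : 0 ≤ 4 * n * K := by positivity
    nlinarith [mul_le_mul_of_nonneg_left h5 h6]
  have h5 : 1 / 2 ≤ K * X := by nlinarith
  have h6 : K * 1 ≤ K * (2 * X) := mul_le_mul_of_nonneg_left (by linarith) (by linarith)
  -- With KX ≥ 1/2 and K ≤ 2KX, the terms 2n, 16nKX and 4nK contribute 4 + 16 + 8 = 28.
  have h7 : n * ∑ m ∈ Finset.range T, distBound (confParam I.n T) I.maxSupport m +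
      t * (4 * n * K * t / (n * t) ^ 3) ≤ 28 * n * K * X := by
    have := mul_le_mul_of_nonneg_left h2 (zero_le_one.trans hn')
    have h8 := mul_le_mul_of_nonneg_left h5 (zero_le_one.trans hn')
    have h9 := mul_le_mul_of_nonneg_left h6 (zero_le_one.trans hn')
    nlinarith
  calc _ ≤ F * (28 * n * K * X) := mul_le_mul_of_nonneg_left h7 hF0
    _ = _ := by ring

end RegretBound

/-! ### Running time -/

section Steps

theorem Timed.steps_bind_le {β γ : Type} {x : Timed β} {g : β → Timed γ} {a b c : ℕ}
    (hx : x.steps ≤ a) (hg : ∀ v, (g v).steps ≤ b) (hc : a + b ≤ c) : (x >>= g).steps ≤ c :=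
  (Nat.add_le_add hx (hg _)).trans hc

/-- The loops cost 2K (total), 3K (frequencies), 4K (search) and 5K (output), and there are 9 scalar
steps. An early exit with a point mass costs 3K, within what is left of the budget. -/
theorem steps_empStocDom_le {K : ℕ} (hK : 0 < K) (δ : ℝ) (c : Fin K → ℕ) :
    (empStocDom hK δ c).steps ≤ 14 * K + 9 := by
  have hsum := Timed.steps_forEach_le (List.finRange K)
    (fun j (s : ℕ) => Timed.op (s + c j)) 0 1 fun _ _ => le_rfl
  have hpoint := Timed.steps_fill_le (fun _ : Fin K => (0 : ℝ))
    (fun j => do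
      Timed.tick
      pure (if j = (⟨K - 1, Nat.sub_lt hK Nat.one_pos⟩ : Fin K) then 1 else 0)) 1 fun _ => le_rfl
  have hfind : ∀ (p : Fin K → ℝ) (ε : ℝ), (Timed.forEach (List.finRange K)
      (fun j (st : ℝ × Option (Fin K × ℝ)) => do
        let s ← Timed.op (st.1 + p j)
        Timed.tick
        Timed.tick
        pure (s, if st.2.isNone ∧ ε ≤ s then some (j, s) else st.2)) (0, none)).steps ≤
      K * (3 + 1) := fun p ε => by
    simpa using Timed.steps_forEach_le (List.finRange K)
      (fun j (st : ℝ × Option (Fin K × ℝ)) => do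
        let s ← Timed.op (st.1 + p j)
        Timed.tick
        Timed.tick
        pure (s, if st.2.isNone ∧ ε ≤ s then some (j, s) else st.2)) (0, none) 3 fun _ _ => le_rfl
  have hemp : ∀ m : ℕ, (Timed.fill (fun _ : Fin K => (0 : ℝ))
      (fun j => Timed.op ((c j : ℝ) / (m : ℝ)))).steps ≤ K * (1 + 2) := fun m =>
    Timed.steps_fill_le _ _ 1 fun _ => le_rfl
  have hfinal : ∀ g : Fin K → ℝ, (Timed.fill (fun _ : Fin K => (0 : ℝ)) (fun j => do
      Timed.tick
      Timed.tick
      Timed.tick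
      pure (g j))).steps ≤ K * (3 + 2) := fun g =>
    Timed.steps_fill_le _ _ 3 fun _ => le_rfl
  rw [List.length_finRange] at hsum
  unfold empStocDom
  refine Timed.steps_bind_le (b := 12 * K + 9) hsum (fun m => ?_) (by omega)
  refine Timed.steps_bind_le (a := 1) (b := 12 * K + 8) le_rfl (fun _ => ?_) (by omega)
  split
  · omega
  refine Timed.steps_bind_le (a := 1) (b := 12 * K + 7) le_rfl (fun _ => ?_) (by omega)
  refine Timed.steps_bind_le (a := 1) (b := 12 * K + 6) le_rfl (fun _ => ?_) (by omega)
  refine Timed.steps_bind_le (a := 1) (b := 12 * K + 5) le_rfl (fun _ => ?_) (by omega)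
  refine Timed.steps_bind_le (a := 1) (b := 12 * K + 4) le_rfl (fun _ => ?_) (by omega)
  refine Timed.steps_bind_le (a := 1) (b := 12 * K + 3) le_rfl (fun ε => ?_) (by omega)
  refine Timed.steps_bind_le (b := 9 * K + 3) (hemp m) (fun p => ?_) (by omega)
  refine Timed.steps_bind_le (a := 1) (b := 9 * K + 2) le_rfl (fun pTop => ?_) (by omega)
  refine Timed.steps_bind_le (a := 1) (b := 9 * K + 1) le_rfl (fun _ => ?_) (by omega)
  split
  · omega
  refine Timed.steps_bind_le (b := 5 * K + 1) (hfind p ε) (fun found => ?_) (by omega)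
  split
  · omega
  · exact Timed.steps_bind_le (a := 1) le_rfl (fun rest => hfinal _) (by omega)

theorem steps_optimisticDist_le (up : Bool) {K : ℕ} (hK : 0 < K) (δ : ℝ) (c : Fin K → ℕ) :
    (optimisticDist up hK δ c).steps ≤ 20 * K + 9 := by
  unfold optimisticDist
  split
  · have := steps_empStocDom_le hK δ c
    omega
  · unfold empStocDomDown
    simp only [Timed.steps_bind]
    have h1 := Timed.steps_fill_le (fun _ : Fin K => (0 : ℕ))
      (fun j => Timed.op (c (Fin.rev j))) 1 fun _ => le_rfl
    have h2 := steps_empStocDom_le hK δ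
      (Timed.fill (fun _ : Fin K => (0 : ℕ)) (fun j => Timed.op (c (Fin.rev j)))).val
    have h3 : ∀ p : Fin K → ℝ, (Timed.fill (fun _ : Fin K => (0 : ℝ))
      (fun j => Timed.op (p (Fin.rev j)))).steps ≤ K * (1 + 2) :=
      fun p => Timed.steps_fill_le _ _ 1 fun _ => le_rfl
    have h4 := h3 (empStocDom hK δ
      (Timed.fill (fun _ : Fin K => (0 : ℕ)) (fun j => Timed.op (c (Fin.rev j)))).val).val
    omega

variable {P : Problem} {M : Monotonicity} {ALG : OfflineAlgorithm} {I : ProbingInstance} {T : ℕ}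
  {α : ℝ}

theorem length_run_le {n : ℕ} {k : Fin n → ℕ} {σ : DTree k} (hσ : σ.ProbesOnce)
    (x : ∀ i, Fin (k i)) : (σ.run x).length ≤ n := by
  have := (hσ x).length_le_card
  simpa using this

/-- A run has at most n probes, hence at most n + 1 prefixes, including the empty one. -/
theorem ExecutablePolicy.execSteps_le {π : ExecutablePolicy I} (hπ : π.tree.ProbesOnce)
    (x : I.Realization) {B : ℕ} (hB : ∀ s ∈ (π.tree.run x).inits, π.nodeSteps s ≤ B) :
    π.execSteps x ≤ (I.n + 1) * (B + 1) := by
  unfold execSteps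
  refine (List.sum_le_card_nsmul _ (B + 1) ?_).trans ?_
  · intro m hm
    obtain ⟨s, hs, rfl⟩ := List.mem_map.1 hm
    exact Nat.succ_le_succ (hB s hs)
  · rw [List.length_map, List.length_inits, smul_eq_mul]
    exact Nat.mul_le_mul_right _ (Nat.succ_le_succ (length_run_le hπ x))

theorem onlineToOffline_select_steps_le {B : ℕ} (hB : ALG.StepsLE I B)
    (c : ∀ i, Fin (I.k i) → ℕ) :
    ((onlineToOffline P M ALG I T).select c).steps ≤
      4 + I.n * (20 * I.maxSupport + 11) + B := by
  have h1 := Timed.steps_fill_le (fun (i : Fin I.n) (_ : Fin (I.k i)) => (0 : ℝ))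
    (fun i => optimisticDist (optimisticUp P.sense M) (I.k_pos i) (confParam I.n T) (c i))
    (20 * I.maxSupport + 9) fun i => (steps_optimisticDist_le _ _ _ _).trans (by
      have := le_maxSupport i; omega)
  have h2 := (hB _ (isDist_optimisticWeights P M I T c)).1
  have h3 : ((onlineToOffline P M ALG I T).select c).steps =
      1 + (1 + (1 + (1 + ((Timed.fill (fun (i : Fin I.n) (_ : Fin (I.k i)) => (0 : ℝ))
        (fun i => optimisticDist (optimisticUp P.sense M) (I.k_pos i)
          (confParam I.n T) (c i))).steps +
        (ALG I (optimisticWeights P M I T c)).steps)))) := by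
    have h4 : optimisticWeights P M I T c =
      (Timed.fill (fun (i : Fin I.n) (_ : Fin (I.k i)) => (0 : ℝ))
        (fun i => optimisticDist (optimisticUp P.sense M) (I.k_pos i)
          (confParam I.n T) (c i))).val := by
      rw [Timed.val_fill]
      rfl
    rw [h4]
    rfl
  rw [h3]
  have h5 : I.n * (20 * I.maxSupport + 9 + 2) = I.n * (20 * I.maxSupport + 11) := rfl
  omega

theorem onlineToOffline_observe_steps_le (c : ∀ i, Fin (I.k i) → ℕ) (s : State I.k) :
    ((onlineToOffline P M ALG I T).observe c s).steps ≤ s.length * 3 :=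
  Timed.steps_forEach_le s _ c 2 fun _ _ => le_rfl

theorem onlineToOffline_start_steps_le :
    (onlineToOffline P M ALG I T).start.steps ≤ I.n * (3 * I.maxSupport + 2) := by
  refine Timed.steps_fill_le _ _ (3 * I.maxSupport) fun i => ?_
  refine (Timed.steps_fill_le _ _ 1 fun _ => le_rfl).trans ?_
  have := le_maxSupport i
  omega

theorem onlineToOffline_stepsFrom_le (hA : P.IsApproximation α ALG) (hI : I ∈ P.instances)
    {B : ℕ} (hB : ALG.StepsLE I B) (xs : List I.Realization) (c : ∀ i, Fin (I.k i) → ℕ) :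
    (onlineToOffline P M ALG I T).stepsFrom c xs ≤
      xs.length * (4 + I.n * (20 * I.maxSupport + 11) + B + (I.n + 1) * (B + 1) + I.n * 3) := by
  induction xs generalizing c with
  | nil => exact Nat.zero_le _
  | cons x xs ih =>
    have hE := isDist_optimisticWeights P M I T c
    have hσ := I.feasible_probesOnce _ (hA.feasible hI hE)
    rw [List.length_cons, Nat.succ_mul]
    change ((onlineToOffline P M ALG I T).select c).steps +
      ((onlineToOffline P M ALG I T).select c).val.execSteps x +
      ((onlineToOffline P M ALG I T).observe c
        (((onlineToOffline P M ALG I T).select c).val.tree.run x)).steps +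
      (onlineToOffline P M ALG I T).stepsFrom ((onlineToOffline P M ALG I T).observe c
        (((onlineToOffline P M ALG I T).select c).val.tree.run x)).val xs ≤ _
    have h1 := onlineToOffline_select_steps_le (P := P) (M := M) (T := T) hB c
    have h2 := ExecutablePolicy.execSteps_le hσ x ((hB _ hE).2 x)
    have h3 := onlineToOffline_observe_steps_le (P := P) (M := M) (ALG := ALG) (T := T) c
      (((onlineToOffline P M ALG I T).select c).val.tree.run x)
    have h4 := ih ((onlineToOffline P M ALG I T).observe c
      (((onlineToOffline P M ALG I T).select c).val.tree.run x)).val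
    rw [onlineToOffline_select_val] at h3 h4 ⊢
    have h5 := length_run_le hσ x
    omega

theorem totalSteps_onlineToOffline_le (hA : P.IsApproximation α ALG) (hI : I ∈ P.instances)
    (hT : 2 ≤ I.n * T) {B : ℕ} (hB : ALG.StepsLE I B) (h : Fin T → I.Realization) :
    (onlineToOffline P M ALG I T).totalSteps h ≤ 45 * I.n * T * (I.maxSupport + B) := by
  have hn : 1 ≤ I.n := by by_contra! h; simp [Nat.lt_one_iff.1 h] at hT
  have hT1 : 1 ≤ T := by by_contra! h; simp [Nat.lt_one_iff.1 h] at hT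
  have hK := one_le_maxSupport hn
  have h1 := onlineToOffline_start_steps_le (P := P) (M := M) (ALG := ALG) (I := I) (T := T)
  have h2 := onlineToOffline_stepsFrom_le (M := M) (T := T) hA hI hB (List.ofFn h)
    (onlineToOffline P M ALG I T).start.val
  rw [List.length_ofFn] at h2
  unfold Learner.totalSteps
  refine (Nat.add_le_add h1 h2).trans ?_
  set n := I.n
  set K := I.maxSupport
  have hnK : n ≤ n * K := Nat.le_mul_of_pos_right n hK
  have hBn : B ≤ n * B := Nat.le_mul_of_pos_left B hn
  -- Initialization is spread over the T ≥ 1 periods; its 5 and the 40 per period give 45.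
  have h3 : n * (3 * K + 2) ≤ T * (5 * (n * K)) :=
    calc n * (3 * K + 2) ≤ 5 * (n * K) := by ring_nf; ring_nf at hnK; omega
      _ ≤ _ := Nat.le_mul_of_pos_left _ hT1
  have h4 : 4 + n * (20 * K + 11) + B + (n + 1) * (B + 1) + n * 3 ≤ 40 * (n * K) + 3 * (n * B) := by
    ring_nf; ring_nf at hnK hBn; omega
  calc _ ≤ T * (5 * (n * K)) + T * (40 * (n * K) + 3 * (n * B)) :=
        Nat.add_le_add h3 (Nat.mul_le_mul_left _ h4)
    _ ≤ 45 * n * T * (K + B) := by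
        ring_nf
        have : T * n * B * 3 ≤ T * n * B * 45 := by gcongr; norm_num
        ring_nf at this
        omega

end Steps

end Probing

theorem theorem1 :
    ∃ C : ℝ, 0 < C ∧
      ∀ (P : Probing.Problem) (α : ℝ) (ALG : Probing.OfflineAlgorithm) (M : Probing.Monotonicity),
        P.IsMonotone M → P.IsApproximation α ALG →
        ∀ I ∈ P.instances, ∀ T : ℕ, 2 ≤ I.n * T →
          (∀ D : I.Weights, I.IsDist D →
            ∀ fmax : ℝ, (∀ σ ∈ I.feasible, ∀ x, I.f (σ.run x) ≤ fmax) →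
              (Probing.onlineToOffline P M ALG I T).regret P.sense α D T ≤
                C * I.n * I.maxSupport * fmax * Real.sqrt (T * Real.log (I.n * T))) ∧
          (∀ B : ℕ, ALG.StepsLE I B →
            ∀ h : Fin T → I.Realization,
              ((Probing.onlineToOffline P M ALG I T).totalSteps h : ℝ) ≤
                C * I.n * T * (I.maxSupport + B)) := by
  -- The larger of the constants 28 (regret) and 45 (steps).
  refine ⟨45, by norm_num, fun P α ALG M hM hA I hI T hT => ⟨fun D hD F hF => ?_, fun B hB h => ?_⟩⟩
  · refine (Probing.regret_onlineToOffline_le hM hA hI hT hD hF).trans ?_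
    have hF0 := Probing.ProbingInstance.bound_nonneg hF
    gcongr
    norm_num
  · exact_mod_cast Probing.totalSteps_onlineToOffline_le hA hI hT hB h
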